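/- **Setting.** Let $X_{\rm free},X_{\rm goal}\subset\mathbb R^n$ be open, $\Omega\subset\mathbb R^m$ bounded, $x_{ic}\in\mathbb R^n$. Let $f:\mathbb R^n\times\Omega\to\mathbb R^n$ be bounded by $M$, Lipschitz in its first argument with constant $L_f>0$ (uniformly in the second), and continuous in its second argument. Let $g:X_{\rm free}\times\Omega\to(0,\infty)$ satisfy $|g(x,v)-g(y,w)|\le L_g(\|x-y\|_2+\|v-w\|_2)$. Let $\mathcal U$ be the set of integrable $u:[0,\tau(u)]\to\Omega$ with $\tau(u)>0$. For $u\in\mathcal U$ let $\varphi_{x_0}(u):[0,\tau(u)]\to\mathbb R^n$ be the ($M$-Lipschitz) solution of $x(t)=x_0+\int_0^t f(x(s),u(s))\,ds$. Let $\mathcal U_{\rm free}$ be the set of $u\in\mathcal U$ such that $\varphi_{x_{ic}}(u)$ stays in $X_{\rm free}$, and $\mathcal U_{\rm goal}$ the set of $u\in\mathcal U_{\rm free}$ such that $\varphi_{x_{ic}}(u)$ moreover ends in $X_{\rm goal}$. Put $J(u)=\int_0^{\tau(u)}g([\varphi_{x_{ic}}(u)](t),u(t))\,dt$, $J(\mathtt{NULL})=\infty$,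 and $c^*=\inf_{u\in\mathcal U_{\rm goal}}J(u)\in[0,\infty]$ (with $\inf\emptyset=\infty$). **Parameters.** For each resolution $R\in\{1,2,\dots\}$ let $\Omega_R\subset\Omega$ be finite, $h(R)\in\{1,2,\dots\}$ and $\eta(R)>0$, such that, as $R\to\infty$, $$\sup_{w\in\Omega}\inf_{v\in\Omega_R}\|w-v\|_2\to0,\qquad \frac{R}{h(R)}\to0,\qquad \frac{R}{L_f\,\eta(R)}\Big(e^{L_f h(R)/R}-1\Big)\to0 .$$ Let $\mathcal U_R$ be the set of signals on $[0,d/R]$, $1\le d\le h(R)$, that are constant with a value in $\Omega_R$ on each of the $d$ consecutive intervals of length $1/R$; $d$ is the depth of the signal. Add a root $Id$ with depth, duration and cost $0$; the children of a signal are its one-step extensions in $\mathcal U_R$. Write $u\sim w$ if the terminal states $p,q$ of the trajectories of $u,w$ from $x_{ic}$ satisfy $\lfloor\eta(R)p\rfloor=\lfloor\eta(R)q\rfloor$ coordinatewise, and $u\prec_R w$ if $u\sim w$, $\tau(u)\le\tau(w)$ and $J(u)\le J(w)$. **GLC method at resolution $R$.** Start with $Q=\{Id\}$ and $\Sigma=\emptyset$.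 While $Q\ne\emptyset$: remove from $Q$ an element $u$ of least cost $J$. If $u\in\mathcal U_{\rm goal}$, return $u$. Otherwise let $S$ be the set of children of $u$, and for each $w\in S$, one after the other: let $z$ be an element of $\Sigma$ with $z\sim w$, or $\mathtt{NULL}$ if there is none; if $w\notin\mathcal U_{\rm free}$, or $z\prec_R w$ (which is false for $z=\mathtt{NULL}$), or the depth of $w$ is at least $h(R)$, remove $w$ from $S$; else, if $J(w)<J(z)$, replace $\Sigma$ by $(\Sigma\setminus\{z\})\cup\{w\}$. Then replace $Q$ by $Q\cup S$. If $Q$ becomes empty, return $\mathtt{NULL}$. Ties in the choice of $u$, the choice of $z$ and the order of the children are arbitrary. **Corollary 5.1.** The GLC method is resolution complete: for every $R\ge1$ it terminates after finitely many steps, however the arbitrary choices are made; and if $w_R$ is a signal returned at resolution $R$, for every $R\ge1$, then $w_R\in\mathcal U_{\rm goal}\cup\{\mathtt{NULL}\}$ for every $R\ge 1$ and $$\lim_{R\to\infty}J(w_R)=c^* .$$ -/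

import Mathlib

namespace GLC

/-- `ℝᵏ` with the Euclidean norm. -/
abbrev Vec (k : ℕ) : Type := EuclideanSpace ℝ (Fin k)

/-- The raw data of an input signal: a terminal time `dur` and the control values.
Only the values on `[0, dur]` are ever used. -/
structure Signal (m : ℕ) where
  dur : ℝ
  val : ℝ → Vec m

/-- The data of an optimal kinodynamic motion planning problem: initial condition, admissible
states, goal states, admissible control inputs, dynamic model, running cost; together with the
speed bound `M` that enters the definition of the trajectory space.  The functions `f` and `g`
are only ever evaluated on `ℝⁿ × Ω` and, for feasible motions, on `Xfree × Ω`. -/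
structure Problem (n m : ℕ) where
  xIc : Vec n
  Xfree : Set (Vec n)
  Xgoal : Set (Vec n)
  Ω : Set (Vec m)
  f : Vec n → Vec m → Vec n
  g : Vec n → Vec m → ℝ
  M : NNReal

namespace Problem

variable {n m : ℕ}

/-- The standing assumptions on the problem data, with constants `uMax`, `Lg`, `Lf`. -/
structure Assumptions (P : Problem n m) (uMax Lg Lf : ℝ) : Prop where
  isOpen_free : IsOpen P.Xfree
  isOpen_goal : IsOpen P.Xgoal
  norm_le_of_mem : ∀ w ∈ P.Ω, ‖w‖ ≤ uMax
  g_pos : ∀ x ∈ P.Xfree, ∀ w ∈ P.Ω, 0 < P.g x w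
  g_lipschitz : ∀ x ∈ P.Xfree, ∀ y ∈ P.Xfree, ∀ v ∈ P.Ω, ∀ w ∈ P.Ω,
    |P.g x v - P.g y w| ≤ Lg * (‖x - y‖ + ‖v - w‖)
  Lf_pos : 0 < Lf
  f_lipschitz : ∀ w ∈ P.Ω, ∀ x y : Vec n, ‖P.f x w - P.f y w‖ ≤ Lf * ‖x - y‖
  f_continuous : ∀ x : Vec n, ContinuousOn (P.f x) P.Ω
  f_bounded : ∀ x : Vec n, ∀ w ∈ P.Ω, ‖P.f x w‖ ≤ P.M

/-- The space of input signals: integrable functions `[0, τ] → Ω` for some `τ > 0`. -/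
def signalSpace (P : Problem n m) : Set (Signal m) :=
  {u | 0 < u.dur ∧ MeasureTheory.IntegrableOn u.val (Set.Icc 0 u.dur) ∧
    ∀ t ∈ Set.Icc 0 u.dur, u.val t ∈ P.Ω}

/-- `x`, restricted to `[0, τ]`, is a trajectory from `x₀`: it starts at `x₀` and is `M`-Lipschitz. -/
def IsTrajectory (P : Problem n m) (x₀ : Vec n) (τ : ℝ) (x : ℝ → Vec n) : Prop :=
  x 0 = x₀ ∧ LipschitzOnWith P.M x (Set.Icc 0 τ)

/-- `x` is a trajectory with the time domain of `u` that solves the integral equation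
`x(t) = x₀ + ∫₀ᵗ f(x(s), u(s)) ds`. -/
def IsSolution (P : Problem n m) (x₀ : Vec n) (u : Signal m) (x : ℝ → Vec n) : Prop :=
  P.IsTrajectory x₀ u.dur x ∧
    ∀ t ∈ Set.Icc 0 u.dur, x t = x₀ + ∫ s in (0 : ℝ)..t, P.f (x s) (u.val s)

/-- The system map: the solution with initial state `x₀` and input signal `u`
(unique on `[0, dur]`; the values outside of this interval are irrelevant). -/
noncomputable def systemMap (P : Problem n m) (x₀ : Vec n) (u : Signal m) : ℝ → Vec n :=
  Classical.epsilon (P.IsSolution x₀ u)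

/-- The state at the terminal time of the trajectory from the initial condition driven by `u`. -/
noncomputable def terminalState (P : Problem n m) (u : Signal m) : Vec n :=
  P.systemMap P.xIc u u.dur

/-- Input signals whose trajectory from the initial condition remains in `Xfree`. -/
def freeSignals (P : Problem n m) : Set (Signal m) :=
  {u | u ∈ P.signalSpace ∧ ∀ t ∈ Set.Icc 0 u.dur, P.systemMap P.xIc u t ∈ P.Xfree}

/-- Input signals whose trajectory remains in `Xfree` and terminates in `Xgoal`. -/
def goalSignals (P : Problem n m) : Set (Signal m) :=
  {u | u ∈ P.freeSignals ∧ P.terminalState u ∈ P.Xgoal}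

/-- The cost `J_{x₀}(u)`. -/
noncomputable def cost (P : Problem n m) (x₀ : Vec n) (u : Signal m) : ℝ :=
  ∫ t in (0 : ℝ)..u.dur, P.g (P.systemMap x₀ u t) (u.val t)

/-- The cost from the initial condition, extended to the symbol `NULL` (here `none`), whose cost
is `∞`. -/
noncomputable def extCost (P : Problem n m) : Option (Signal m) → EReal
  | none => ⊤
  | some u => ((P.cost P.xIc u : ℝ) : EReal)

/-- The optimal cost `c* = inf J` over the goal signals, equal to `∞` if there are none. -/
noncomputable def optimalCost (P : Problem n m) : EReal :=
  ⨅ u ∈ P.goalSignals, P.extCost (some u)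

end Problem

/-- The parameters of the method: the finite sets `Ω_R` of control values, the horizon limit `h`
and the partition scaling `η`, all indexed by the resolution `R`. -/
structure Params (m : ℕ) where
  Ω : ℕ → Finset (Vec m)
  h : ℕ → ℕ
  η : ℕ → ℝ

/-- The requirements on the parameters.  The dispersion of `Ω_R` in `Ω` is computed in `[0, ∞]`,
so it is infinite if `Ω_R` is empty and `Ω` is not. -/
structure Params.Admissible {n m : ℕ} (T : Params m) (P : Problem n m) (Lf : ℝ) : Prop where
  subset : ∀ R, 1 ≤ R → (T.Ω R : Set (Vec m)) ⊆ P.Ω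
  dispersion : Filter.Tendsto
    (fun R : ℕ => ⨆ w ∈ P.Ω, ⨅ v ∈ T.Ω R, edist w v) Filter.atTop (nhds 0)
  h_pos : ∀ R, 1 ≤ R → 0 < T.h R
  horizon : Filter.Tendsto (fun R : ℕ => (R : ℝ) / (T.h R : ℝ)) Filter.atTop (nhds 0)
  η_pos : ∀ R, 1 ≤ R → 0 < T.η R
  scaling : Filter.Tendsto
    (fun R : ℕ => (R : ℝ) / (Lf * T.η R) * (Real.exp (Lf * (T.h R : ℝ) / (R : ℝ)) - 1))
    Filter.atTop (nhds 0)

/-- A string of primitive input signals, each of duration `1/R` and identified with its constant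
control value.  The empty string is the root `Id`, of duration `0`. -/
abbrev Word (m : ℕ) : Type := List (Vec m)

/-- The piecewise constant signal on `[0, d/R]` given by a string `v₁ ⋯ v_d`: it has the value
`v_i` on `[(i-1)/R, i/R)`, and `v_d` also at the terminal time. -/
noncomputable def Word.signal {m : ℕ} (R : ℕ) (w : Word m) : Signal m where
  dur := (w.length : ℝ) / (R : ℝ)
  val := fun t => w.getD (min ⌊t * (R : ℝ)⌋₊ (w.length - 1)) 0

section Algorithm

variable {n m : ℕ} (P : Problem n m) (T : Params m) (R : ℕ)

/-- The approximation `𝒰_R` of the signal space: nonempty strings of length at most `h(R)` of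
primitive signals with values in `Ω_R`. -/
def words : Set (Word m) :=
  {w | w ≠ [] ∧ w.length ≤ T.h R ∧ ∀ v ∈ w, v ∈ T.Ω R}

/-- `expand(u)`: the set of all children of `u`. -/
def expand (u : Word m) : Set (Word m) :=
  {w | w ∈ words T R ∧ ∃ v, w = u ++ [v]}

/-- The depth of a string in the tree rooted at `Id`. -/
def depth (u : Word m) : ℕ := u.length

/-- Equivalence of states: they lie in the same cell of the hypercube partition. -/
def StateEquiv (p q : Vec n) : Prop :=
  ∀ i, ⌊T.η R * p i⌋ = ⌊T.η R * q i⌋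

/-- Equivalence of signals: the resulting trajectories terminate in the same cell. -/
def WordEquiv (u w : Word m) : Prop :=
  StateEquiv T R (P.terminalState (u.signal R)) (P.terminalState (w.signal R))

/-- The relation `u ≺_R w` given by the three GLC conditions. -/
def Prec (u w : Word m) : Prop :=
  WordEquiv P T R u w ∧ (u.signal R).dur ≤ (w.signal R).dur ∧
    P.cost P.xIc (u.signal R) ≤ P.cost P.xIc (w.signal R)

/-- `u` is a possible answer of `pop(Q)`: an element of `Q` of least cost. -/
def IsPop (Q : Set (Word m)) (u : Word m) : Prop :=
  u ∈ Q ∧ ∀ w ∈ Q, P.cost P.xIc (u.signal R) ≤ P.cost P.xIc (w.signal R)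

/-- `z` is a possible answer of `find(w, L)`: an element of `L` equivalent to `w`, or `NULL` if
there is none. -/
def IsFind (L : Set (Word m)) (w : Word m) : Option (Word m) → Prop
  | none => ∀ z ∈ L, ¬ WordEquiv P T R w z
  | some z => z ∈ L ∧ WordEquiv P T R w z

/-- The condition under which the child `w` is discarded, `z` being the answer of `find`
(the test `z ≺_R w` fails for `z = NULL`). -/
def Discard (w : Word m) (z : Option (Word m)) : Prop :=
  w.signal R ∉ P.freeSignals ∨ (∃ z', z = some z' ∧ Prec P T R z' w) ∨ T.h R ≤ depth w

/-- The test `J(w) < J(z)`, where `J(NULL) = ∞`. -/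
def Improves (w : Word m) (z : Option (Word m)) : Prop :=
  P.extCost (some (w.signal R)) < P.extCost (z.map (Word.signal R))

/-- `ForLoop l S L S' L'`: processing the children in the list `l` in turn changes the
set of children from `S` to `S'` and the set of labels from `L` to `L'`. -/
inductive ForLoop : List (Word m) → Set (Word m) → Set (Word m) →
    Set (Word m) → Set (Word m) → Prop
  | nil (S L : Set (Word m)) : ForLoop [] S L S L
  | discard {w : Word m} {l : List (Word m)} {z : Option (Word m)}
      {S L S' L' : Set (Word m)} (hfind : IsFind P T R L w z)
      (hdiscard : Discard P T R w z) (hrest : ForLoop l (S \ {w}) L S' L') :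
      ForLoop (w :: l) S L S' L'
  | relabel {w : Word m} {l : List (Word m)} {z : Option (Word m)}
      {S L S' L' : Set (Word m)} (hfind : IsFind P T R L w z)
      (hkeep : ¬ Discard P T R w z) (himproves : Improves P R w z)
      (hrest : ForLoop l S ((L \ {z' | z = some z'}) ∪ {w}) S' L') :
      ForLoop (w :: l) S L S' L'
  | keep {w : Word m} {l : List (Word m)} {z : Option (Word m)}
      {S L S' L' : Set (Word m)} (hfind : IsFind P T R L w z)
      (hkeep : ¬ Discard P T R w z) (himproves : ¬ Improves P R w z)
      (hrest : ForLoop l S L S' L') :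
      ForLoop (w :: l) S L S' L'

/-- A configuration of the algorithm: running, with a queue and a set of labels, or stopped, with
the returned signal or `NULL`. -/
inductive Config (m : ℕ) : Type
  | running (Q L : Set (Word m)) : Config m
  | returned (out : Option (Signal m)) : Config m

/-- One pass through the main loop of the algorithm.  Ties in `pop` are broken arbitrarily, and
the children are processed in an arbitrary order. -/
inductive Step : Config m → Config m → Prop
  | fail (L : Set (Word m)) : Step (.running ∅ L) (.returned none)
  | goal {Q L : Set (Word m)} {u : Word m} (hpop : IsPop P R Q u)
      (hgoal : u.signal R ∈ P.goalSignals) :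
      Step (.running Q L) (.returned (some (u.signal R)))
  | expand {Q L S' L' : Set (Word m)} {u : Word m} {l : List (Word m)} (hpop : IsPop P R Q u)
      (hgoal : u.signal R ∉ P.goalSignals) (hnodup : l.Nodup)
      (hmem : ∀ w, w ∈ l ↔ w ∈ GLC.expand T R u)
      (hloop : ForLoop P T R l (GLC.expand T R u) L S' L') :
      Step (.running Q L) (.running ((Q \ {u}) ∪ S') L')

/-- The initial configuration: the queue holds only the root `Id`, and there are no labels. -/
def initial (m : ℕ) : Config m := .running {[]} ∅

/-- `c` occurs in some execution of the algorithm. -/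
def Reachable (c : Config m) : Prop :=
  Relation.ReflTransGen (Step P T R) (initial m) c

/-- `out` is a possible output of the algorithm at resolution `R`. -/
def Returns (out : Option (Signal m)) : Prop :=
  Reachable P T R (.returned out)

/-- The algorithm terminates at resolution `R`: there is no infinite execution, and an execution
can always be continued until an output is returned. -/
def Terminates : Prop :=
  (¬ ∃ c : ℕ → Config m, c 0 = initial m ∧ ∀ k, Step P T R (c k) (c (k + 1))) ∧
    ∀ c, Reachable P T R c → (∃ out, c = .returned out) ∨ ∃ c', Step P T R c c'

end Algorithm

end GLC

/-! An output is a goal signal or `NULL`, so its cost is at least c* at every resolution. The work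
lies in bounding it by J(u) + ε for a fixed goal signal u and all large R.

Density (`exists_word_near`). Averaging u over the cells of the time grid and rounding to Ω_R gives
controls that converge to u almost everywhere, by Lebesgue differentiation. Gronwall and dominated
convergence carry this over to trajectories, uniformly, and to costs. Since X_free and X_goal are
open, the resulting strings w have a clearance δ independent of R.

Pruning (`Explored.exists_mem_cost_le`). The search need not visit w, but it shadows w. Call a
string known if it is queued or expanded. By induction on k, as long as the chain avoids the queue,
some known string of length at most k ends near the state of w at time k/R and costs little more
than the first k steps of w. Its child by the next letter of w is free, by the clearance; if that
child was pruned, a known string in the same cell, neither longer nor dearer, replaces it. A step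
multiplies the error by at most e^{Lf/R} and a replacement adds at most a cell diameter √n/η, so the
error is a geometric sum, which the scaling condition sends to 0. The chain must meet the queue:
otherwise it ends in an expanded string that reaches the goal, but goal strings are returned, not
expanded. So the queue is never empty and its cheapest element costs hardly more than w.

Termination (`terminates`). Give a queued string the weight (|Ω_R| + 1)^(h - length); every
expansion lowers the total weight. -/

namespace GLC

open MeasureTheory Set Filter Topology

/-! ### Analytic tools: measurability, Picard iteration, Gronwall. -/

/-- A continuous function on a set, composed with an a.e. measurable map into that set. -/
theorem aestronglyMeasurable_comp_of_continuousOn {α X F : Type*} [MeasurableSpace α]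
    [TopologicalSpace X] [SecondCountableTopology X] [MeasurableSpace X] [OpensMeasurableSpace X]
    [NormedAddCommGroup F] {μ : Measure α} {S : Set X} {h : X → F} {p : α → X}
    (hh : ContinuousOn h S) (hp : AEMeasurable p μ) (hmem : ∀ᵐ a ∂μ, p a ∈ S) :
    AEStronglyMeasurable (fun a => h (p a)) μ := by
  rcases S.eq_empty_or_nonempty with rfl | hne
  · have : μ = 0 := by simpa using hmem
    subst this
    exact aestronglyMeasurable_zero_measure _
  · obtain ⟨q, hq, hqS, hpq⟩ := hp.exists_ae_eq_range_subset hmem hne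
    have hq' : ∀ a, q a ∈ S := fun a => hqS (mem_range_self a)
    have h1 : StronglyMeasurable (S.domRestrict h) :=
      (continuousOn_iff_continuous_domRestrict.1 hh).stronglyMeasurable
    have h2 : Measurable (fun a => (⟨q a, hq' a⟩ : S)) := hq.subtype_mk
    refine ⟨_, h1.comp_measurable h2, ?_⟩
    filter_upwards [hpq] with a ha
    simp [ha, domRestrict]

/-- Picard iteration for an integral equation whose right hand side is only measurable in time. -/
theorem exists_integral_solution {E : Type*} [NormedAddCommGroup E] [NormedSpace ℝ E]
    [CompleteSpace E] {Φ : ℝ → E → E} {L : ℝ} {M : NNReal} (hL0 : 0 < L)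
    (hL : ∀ s x y, ‖Φ s x - Φ s y‖ ≤ L * ‖x - y‖) (hM : ∀ s x, ‖Φ s x‖ ≤ M)
    (hmeas : ∀ x : ℝ → E, Continuous x → AEStronglyMeasurable (fun s => Φ s (x s)) volume)
    (x₀ : E) :
    ∃ x : ℝ → E, LipschitzWith M x ∧ ∀ t, 0 ≤ t → x t = x₀ + ∫ s in (0 : ℝ)..t, Φ s (x s) := by
  have hint : ∀ x : ℝ → E, Continuous x → ∀ a b,
      IntervalIntegrable (fun s => Φ s (x s)) volume a b := fun x hx a b =>
    (intervalIntegrable_const (c := (M : ℝ))).mono_fun (hmeas x hx).restrict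
      (Eventually.of_forall fun s => by simpa using hM s (x s))
  -- Clamping at 0 keeps every iterate continuous on all of ℝ, as `hmeas` requires.
  let T : (ℝ → E) → ℝ → E := fun x t => x₀ + ∫ s in (0 : ℝ)..(max t 0), Φ s (x s)
  have hTlip : ∀ x : ℝ → E, Continuous x → LipschitzWith M (T x) := fun x hx => by
    refine LipschitzWith.of_dist_le_mul fun a b => ?_
    simp only [T, dist_eq_norm, add_sub_add_left_eq_sub]
    rw [intervalIntegral.integral_interval_sub_left (hint x hx _ _) (hint x hx _ _)]
    refine (intervalIntegral.norm_integral_le_of_norm_le_const fun s _ => hM s (x s)).trans ?_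
    gcongr
    simpa [Real.norm_eq_abs] using abs_max_sub_max_le_abs a b 0
  let X : ℕ → ℝ → E := fun k => T^[k] (fun _ => x₀)
  have hXsucc : ∀ k, X (k + 1) = T (X k) := fun k => Function.iterate_succ_apply' T k _
  have hXlip : ∀ k, LipschitzWith M (X k) := by
    intro k
    induction k with
    | zero => exact (LipschitzWith.const x₀).weaken zero_le
    | succ k ih => rw [hXsucc]; exact hTlip _ ih.continuous
  -- The weight e^{2Lt} makes the iteration a contraction with factor 1/2 on every bounded interval,
  -- since ∫₀ᵗ L e^{2Ls} ds ≤ e^{2Lt}/2. This C starts the induction: M t = C L t ≤ C e^{2Lt}.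
  let C : ℝ := M / L
  have hC : 0 ≤ C := by positivity
  have hdiff : ∀ k t, ‖X (k + 1) t - X k t‖ ≤ C * Real.exp (2 * L * max t 0) / 2 ^ k := by
    intro k
    induction k with
    | zero =>
      intro t
      have h0 : X 1 t - X 0 t = ∫ s in (0 : ℝ)..(max t 0), Φ s (X 0 s) := by
        rw [hXsucc 0]; simp [T, X]
      have h1 := intervalIntegral.norm_integral_le_of_norm_le_const (a := 0) (b := max t 0)
        (f := fun s => Φ s (X 0 s)) (C := M) fun s _ => hM s _
      rw [sub_zero, abs_of_nonneg (le_max_right t 0)] at h1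
      rw [zero_add, h0]
      refine h1.trans ?_
      have h2 : L * max t 0 ≤ Real.exp (2 * L * max t 0) := by
        have := Real.add_one_le_exp (2 * L * max t 0)
        nlinarith [mul_nonneg hL0.le (le_max_right t 0)]
      calc (M : ℝ) * max t 0 = C * (L * max t 0) := by simp only [C]; field_simp
        _ ≤ C * Real.exp (2 * L * max t 0) := by gcongr
        _ = _ := by simp
    | succ k ih =>
      intro t
      have h0 : X (k + 1 + 1) t - X (k + 1) t
          = ∫ s in (0 : ℝ)..(max t 0), (Φ s (X (k + 1) s) - Φ s (X k s)) := by
        rw [intervalIntegral.integral_sub (hint _ (hXlip _).continuous _ _)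
          (hint _ (hXlip _).continuous _ _)]
        rw [hXsucc (k + 1), hXsucc k]
        simp only [T, add_sub_add_left_eq_sub]
      rw [h0]
      have hexp : ∀ s, HasDerivAt (fun s => C / 2 ^ (k + 1) * Real.exp (2 * L * s))
          (L * (C * Real.exp (2 * L * s) / 2 ^ k)) s := by
        intro s
        have := (((hasDerivAt_id s).const_mul (2 * L)).exp).const_mul (C / 2 ^ (k + 1))
        convert! this using 1
        simp only [id]
        field_simp
        ring
      have hcont : Continuous fun s => L * (C * Real.exp (2 * L * s) / 2 ^ k) := by fun_prop
      have hI := intervalIntegral.integral_eq_sub_of_hasDerivAt (a := 0) (b := max t 0)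
        (fun s _ => hexp s) (hcont.intervalIntegrable _ _)
      refine (intervalIntegral.norm_integral_le_of_norm_le (le_max_right t 0)
        (g := fun s => L * (C * Real.exp (2 * L * s) / 2 ^ k))
        (Eventually.of_forall fun s hs => ?_) (hcont.intervalIntegrable _ _)).trans ?_
      · refine (hL s _ _).trans ?_
        have := ih s
        rw [max_eq_left hs.1.le] at this
        gcongr
      · rw [hI]
        have : 0 ≤ C / 2 ^ (k + 1) := by positivity
        simp only [mul_zero, Real.exp_zero, mul_one]
        calc _ ≤ C / 2 ^ (k + 1) * Real.exp (2 * L * max t 0) := by linarith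
          _ = _ := by ring
  have hgeom : ∀ t k, dist (X k t) (X (k + 1) t)
      ≤ 2 * (C * Real.exp (2 * L * max t 0)) / 2 / 2 ^ k := by
    intro t k
    rw [dist_comm, dist_eq_norm, mul_div_cancel_left₀ _ (two_ne_zero' ℝ)]
    exact hdiff k t
  have hlim : ∀ t, ∃ y, Tendsto (fun k => X k t) atTop (𝓝 y) := fun t =>
    cauchySeq_tendsto_of_complete (cauchySeq_of_le_geometric_two (hgeom t))
  choose x hx using hlim
  have hxlip : LipschitzWith M x := by
    refine LipschitzWith.of_dist_le_mul fun a b => ?_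
    exact le_of_tendsto ((hx a).dist (hx b)) (Eventually.of_forall fun k =>
      (hXlip k).dist_le_mul a b)
  refine ⟨x, hxlip, fun t ht => ?_⟩
  have h1 : Tendsto (fun k => X (k + 1) t) atTop (𝓝 (x t)) := (hx t).comp (tendsto_add_atTop_nat 1)
  have h2 : Tendsto (fun k => X (k + 1) t) atTop (𝓝 (x₀ + ∫ s in (0 : ℝ)..t, Φ s (x s))) := by
    have : ∀ k, X (k + 1) t = x₀ + ∫ s in (0 : ℝ)..t, Φ s (X k s) := fun k => by
      rw [hXsucc]; simp [T, max_eq_left ht]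
    simp only [this]
    refine Tendsto.const_add _ ?_
    refine intervalIntegral.tendsto_integral_filter_of_dominated_convergence (fun _ => (M : ℝ))
      (Eventually.of_forall fun k => (hmeas _ (hXlip k).continuous).restrict)
      (Eventually.of_forall fun k => Eventually.of_forall fun s _ => hM s _)
      intervalIntegrable_const (Eventually.of_forall fun s _ => ?_)
    have hc : Continuous (Φ s) := by
      refine (LipschitzWith.of_dist_le_mul (K := ⟨L, hL0.le⟩) fun a b => ?_).continuous
      rw [dist_eq_norm, dist_eq_norm]; exact hL s a b
    exact (hc.tendsto _).comp (hx s)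
  exact tendsto_nhds_unique h1 h2

/-- Gronwall's inequality in integral form. -/
theorem le_mul_exp_of_le_add_integral {u : ℝ → ℝ} {a L τ : ℝ} (hτ : 0 ≤ τ) (hL : 0 ≤ L)
    (hu : ContinuousOn u (Icc 0 τ))
    (h : ∀ t ∈ Icc 0 τ, u t ≤ a + L * ∫ s in (0 : ℝ)..t, u s) :
    ∀ t ∈ Icc 0 τ, u t ≤ a * Real.exp (L * t) := by
  -- A continuous extension to ℝ makes the integral differentiable everywhere, including at the
  -- endpoints.
  let v : ℝ → ℝ := IccExtend hτ ((Icc 0 τ).domRestrict u)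
  have hv : Continuous v := (continuousOn_iff_continuous_domRestrict.1 hu).Icc_extend'
  have hvu : ∀ t ∈ Icc 0 τ, v t = u t := fun t ht => by simp [v, IccExtend_of_mem hτ _ ht, domRestrict]
  have hvint : ∀ t ∈ Icc 0 τ, ∫ s in (0 : ℝ)..t, v s = ∫ s in (0 : ℝ)..t, u s := fun t ht => by
    refine intervalIntegral.integral_congr fun s hs => hvu s ?_
    rw [uIcc_of_le ht.1] at hs
    exact ⟨hs.1, hs.2.trans ht.2⟩
  let Ψ : ℝ → ℝ := fun t => a + L * ∫ s in (0 : ℝ)..t, v s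
  have hΨ : ∀ t, HasDerivAt Ψ (L * v t) t := fun t =>
    ((intervalIntegral.integral_hasDerivAt_right (hv.intervalIntegrable _ _)
      (hv.stronglyMeasurableAtFilter _ _) hv.continuousAt).const_mul L).const_add a
  have hle : ∀ t ∈ Icc 0 τ, u t ≤ Ψ t := fun t ht => by
    simpa only [Ψ, hvint t ht] using h t ht
  have hg : ∀ t ∈ Icc 0 τ, Ψ t ≤ gronwallBound a L 0 (t - 0) := by
    refine le_gronwallBound_of_liminf_deriv_right_le (f' := fun t => L * v t)
      (fun t _ => (hΨ t).continuousAt.continuousWithinAt)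
      (fun t _ r hr => (hΨ t).hasDerivWithinAt.liminf_right_slope_le hr) (by simp [Ψ]) ?_
    intro t ht
    have ht' := Ico_subset_Icc_self ht
    rw [hvu t ht', add_zero]
    exact mul_le_mul_of_nonneg_left (hle t ht') hL
  intro t ht
  have := hg t ht
  rw [sub_zero, gronwallBound_ε0] at this
  exact (hle t ht).trans this

/-- Continuous dependence of the solutions of integral equations on the data. -/
theorem norm_sub_le_of_integral_eq {E : Type*} [NormedAddCommGroup E] [NormedSpace ℝ E]
    {y₁ y₂ φ₁ φ₂ : ℝ → E} {p₁ p₂ : E} {β : ℝ → ℝ} {τ L : ℝ} (hτ : 0 ≤ τ) (hL : 0 ≤ L)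
    (hy₁ : ContinuousOn y₁ (Icc 0 τ)) (hy₂ : ContinuousOn y₂ (Icc 0 τ))
    (h₁ : ∀ t ∈ Icc 0 τ, y₁ t = p₁ + ∫ s in (0 : ℝ)..t, φ₁ s)
    (h₂ : ∀ t ∈ Icc 0 τ, y₂ t = p₂ + ∫ s in (0 : ℝ)..t, φ₂ s)
    (hi₁ : IntervalIntegrable φ₁ volume 0 τ) (hi₂ : IntervalIntegrable φ₂ volume 0 τ)
    (hβ : IntervalIntegrable β volume 0 τ) (hβ0 : ∀ᵐ s ∂volume.restrict (Icc 0 τ), 0 ≤ β s)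
    (h : ∀ᵐ s ∂volume.restrict (Icc 0 τ), ‖φ₁ s - φ₂ s‖ ≤ L * ‖y₁ s - y₂ s‖ + β s) :
    ∀ t ∈ Icc 0 τ, ‖y₁ t - y₂ t‖ ≤ (‖p₁ - p₂‖ + ∫ s in (0 : ℝ)..τ, β s) * Real.exp (L * t) := by
  have hyc : ContinuousOn (fun t => ‖y₁ t - y₂ t‖) (Icc 0 τ) := (hy₁.sub hy₂).norm
  refine le_mul_exp_of_le_add_integral hτ hL hyc fun t ht => ?_
  have hsub : uIcc 0 t ⊆ uIcc 0 τ := by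
    rw [uIcc_of_le ht.1, uIcc_of_le hτ]; exact Icc_subset_Icc_right ht.2
  have hyi : IntervalIntegrable (fun t => ‖y₁ t - y₂ t‖) volume 0 t := by
    refine ContinuousOn.intervalIntegrable (hyc.mono ?_)
    rwa [← uIcc_of_le hτ]
  have hβt : IntervalIntegrable β volume 0 t := hβ.mono_set hsub
  have e : y₁ t - y₂ t = (p₁ - p₂) + ∫ s in (0 : ℝ)..t, (φ₁ s - φ₂ s) := by
    rw [h₁ t ht, h₂ t ht,
      intervalIntegral.integral_sub (hi₁.mono_set hsub) (hi₂.mono_set hsub)]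
    abel
  rw [ae_restrict_iff' measurableSet_Icc] at h
  have b1 : ‖∫ s in (0 : ℝ)..t, (φ₁ s - φ₂ s)‖
      ≤ ∫ s in (0 : ℝ)..t, (L * ‖y₁ s - y₂ s‖ + β s) := by
    refine intervalIntegral.norm_integral_le_of_norm_le ht.1 ?_ ((hyi.const_mul L).add hβt)
    filter_upwards [h] with s hs hst
    exact hs ⟨hst.1.le, hst.2.trans ht.2⟩
  rw [intervalIntegral.integral_add (hyi.const_mul L) hβt,
    intervalIntegral.integral_const_mul] at b1
  have b2 : ∫ s in (0 : ℝ)..t, β s ≤ ∫ s in (0 : ℝ)..τ, β s :=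
    intervalIntegral.integral_mono_interval le_rfl ht.1 ht.2
      (ae_restrict_of_ae_restrict_of_subset Ioc_subset_Icc_self hβ0) hβ
  rw [e]
  refine (norm_add_le _ _).trans ?_
  linarith

end GLC

namespace GLC

open MeasureTheory Set Filter Topology

/-! ### Well-posedness of the control system. -/

namespace Problem

variable {n m : ℕ} {P : Problem n m} {uMax Lg Lf : ℝ}

/-- `c` is an admissible control on `[0, τ]`, up to a null set. -/
structure IsControl (P : Problem n m) (τ : ℝ) (c : ℝ → Vec m) : Prop where
  aestronglyMeasurable : AEStronglyMeasurable c (volume.restrict (Icc 0 τ))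
  mem : ∀ᵐ s ∂volume.restrict (Icc 0 τ), c s ∈ P.Ω

theorem IsControl.mono {τ τ' : ℝ} {c : ℝ → Vec m} (h : P.IsControl τ c) (hle : τ' ≤ τ) :
    P.IsControl τ' c :=
  ⟨h.1.mono_measure (Measure.restrict_mono (Icc_subset_Icc_right hle) le_rfl),
    ae_restrict_of_ae_restrict_of_subset (Icc_subset_Icc_right hle) h.2⟩

theorem isControl_of_mem_signalSpace {u : Signal m} (hu : u ∈ P.signalSpace) :
    P.IsControl u.dur u.val :=
  ⟨hu.2.1.aestronglyMeasurable, (ae_restrict_iff' measurableSet_Icc).2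
    (Eventually.of_forall hu.2.2)⟩

namespace Assumptions

variable (hP : P.Assumptions uMax Lg Lf)
include hP

theorem continuousOn_f : ContinuousOn (fun p : Vec n × Vec m => P.f p.1 p.2) (univ ×ˢ P.Ω) := by
  refine continuousOn_prod_of_continuousOn_lipschitzOnWith _ Lf.toNNReal
    (fun x _ => hP.f_continuous x) (fun w hw => ?_)
  refine LipschitzOnWith.of_dist_le_mul fun x _ y _ => ?_
  rw [dist_eq_norm, dist_eq_norm, Real.coe_toNNReal _ hP.Lf_pos.le]
  exact hP.f_lipschitz w hw x y

/-- No sign of `Lg` is assumed; with |Lg| the bound becomes monotone in the distances. -/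
theorem abs_g_sub_le {x y : Vec n} {v w : Vec m} (hx : x ∈ P.Xfree) (hy : y ∈ P.Xfree)
    (hv : v ∈ P.Ω) (hw : w ∈ P.Ω) : |P.g x v - P.g y w| ≤ |Lg| * (‖x - y‖ + ‖v - w‖) :=
  (hP.g_lipschitz x hx y hy v hv w hw).trans
    (mul_le_mul_of_nonneg_right (le_abs_self _) (by positivity))

theorem continuousOn_g :
    ContinuousOn (fun p : Vec n × Vec m => P.g p.1 p.2) (P.Xfree ×ˢ P.Ω) := by
  have : LipschitzOnWith (|Lg| * 2).toNNReal (fun p : Vec n × Vec m => P.g p.1 p.2)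
      (P.Xfree ×ˢ P.Ω) := by
    refine LipschitzOnWith.of_dist_le_mul fun p hp q hq => ?_
    rw [Real.dist_eq, Real.coe_toNNReal _ (by positivity), mul_assoc]
    refine (hP.abs_g_sub_le hp.1 hq.1 hp.2 hq.2).trans
      (mul_le_mul_of_nonneg_left ?_ (abs_nonneg _))
    have h1 : ‖p.1 - q.1‖ ≤ dist p q := by
      rw [← dist_eq_norm, Prod.dist_eq]; exact le_max_left _ _
    have h2 : ‖p.2 - q.2‖ ≤ dist p q := by
      rw [← dist_eq_norm, Prod.dist_eq]; exact le_max_right _ _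
    linarith
  exact this.continuousOn

theorem aestronglyMeasurable_f {τ : ℝ} {c : ℝ → Vec m} {x : ℝ → Vec n} (hc : P.IsControl τ c)
    (hx : ContinuousOn x (Icc 0 τ)) :
    AEStronglyMeasurable (fun s => P.f (x s) (c s)) (volume.restrict (Icc 0 τ)) :=
  aestronglyMeasurable_comp_of_continuousOn (p := fun s => (x s, c s)) hP.continuousOn_f
    ((hx.aestronglyMeasurable measurableSet_Icc).aemeasurable.prodMk hc.1.aemeasurable)
    (by filter_upwards [hc.2] with s hs using ⟨mem_univ _, hs⟩)

theorem intervalIntegrable_f {τ : ℝ} {c : ℝ → Vec m} {x : ℝ → Vec n} (hτ : 0 ≤ τ)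
    (hc : P.IsControl τ c) (hx : ContinuousOn x (Icc 0 τ)) :
    IntervalIntegrable (fun s => P.f (x s) (c s)) volume 0 τ := by
  rw [intervalIntegrable_iff_integrableOn_Icc_of_le hτ]
  refine Integrable.of_bound ?_ P.M ?_
  · exact hP.aestronglyMeasurable_f hc hx
  · filter_upwards [hc.2] with s hs using hP.f_bounded _ _ hs

/-- The running cost is not assumed bounded. Along a trajectory it is, by its Lipschitz bound,
because the trajectory and Ω are bounded. -/
theorem intervalIntegrable_g {τ : ℝ} {c : ℝ → Vec m} {x : ℝ → Vec n} (hτ : 0 ≤ τ)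
    (hc : P.IsControl τ c) (hx : ContinuousOn x (Icc 0 τ)) (hfree : ∀ t ∈ Icc 0 τ, x t ∈ P.Xfree) :
    IntervalIntegrable (fun s => P.g (x s) (c s)) volume 0 τ := by
  rw [intervalIntegrable_iff_integrableOn_Icc_of_le hτ]
  rcases P.Ω.eq_empty_or_nonempty with h0 | ⟨w, hw⟩
  · have h2 := hc.2
    simp only [h0, mem_empty_iff_false, eventually_false_iff_eq_bot, ae_eq_bot] at h2
    rw [IntegrableOn, h2]
    exact integrable_zero_measure
  obtain ⟨C, hC⟩ := isCompact_Icc.exists_bound_of_continuousOn hx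
  have h0 : (0 : ℝ) ∈ Icc 0 τ := ⟨le_rfl, hτ⟩
  refine Integrable.of_bound ?_ (|P.g (x 0) w| + |Lg| * ((C + C) + (uMax + uMax))) ?_
  · exact aestronglyMeasurable_comp_of_continuousOn (p := fun s => (x s, c s)) hP.continuousOn_g
      ((hx.aestronglyMeasurable measurableSet_Icc).aemeasurable.prodMk hc.1.aemeasurable)
      (by filter_upwards [hc.2, ae_restrict_mem measurableSet_Icc] with s hs hs' using
            ⟨hfree s hs', hs⟩)
  · filter_upwards [hc.2, ae_restrict_mem measurableSet_Icc] with s hs hs'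
    have h1 := hP.abs_g_sub_le (hfree s hs') (hfree 0 h0) hs hw
    have h2 : |Lg| * (‖x s - x 0‖ + ‖c s - w‖) ≤ |Lg| * ((C + C) + (uMax + uMax)) := by
      refine mul_le_mul_of_nonneg_left (add_le_add ?_ ?_) (abs_nonneg _)
      · exact (norm_sub_le _ _).trans (add_le_add (hC s hs') (hC 0 h0))
      · exact (norm_sub_le _ _).trans
          (add_le_add (hP.norm_le_of_mem _ hs) (hP.norm_le_of_mem _ hw))
    have h3 := abs_sub_abs_le_abs_sub (P.g (x s) (c s)) (P.g (x 0) w)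
    rw [Real.norm_eq_abs]
    linarith

theorem exists_isSolution (x₀ : Vec n) {u : Signal m} (hu : P.IsControl u.dur u.val) :
    ∃ x, P.IsSolution x₀ u x := by
  rcases P.Ω.eq_empty_or_nonempty with h0 | hne
  · have h2 := hu.2
    simp only [h0, mem_empty_iff_false, eventually_false_iff_eq_bot, ae_eq_bot,
      Measure.restrict_eq_zero] at h2
    refine ⟨fun _ => x₀, ⟨rfl, (LipschitzWith.const x₀).weaken zero_le |>.lipschitzOnWith⟩,
      fun t ht => ?_⟩
    have : u.dur ≤ 0 := by simpa using h2
    have : t = 0 := le_antisymm (ht.2.trans this) ht.1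
    simp [this]
  -- Picard iteration needs the bounds on f at every time, hence a measurable version of the control
  -- with all its values in Ω.
  · obtain ⟨c, hc, hcΩ, huc⟩ := hu.1.aemeasurable.exists_ae_eq_range_subset hu.2 hne
    have hc' : ∀ s, c s ∈ P.Ω := fun s => hcΩ (mem_range_self s)
    obtain ⟨x, hxlip, hx⟩ := exists_integral_solution (Φ := fun s y => P.f y (c s)) hP.Lf_pos
      (fun s y z => hP.f_lipschitz _ (hc' s) y z) (fun s y => hP.f_bounded y _ (hc' s))
      (fun y hy => aestronglyMeasurable_comp_of_continuousOn (p := fun s => (y s, c s))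
        hP.continuousOn_f (hy.measurable.prodMk hc).aemeasurable
        (Eventually.of_forall fun s => ⟨mem_univ _, hc' s⟩)) x₀
    refine ⟨x, ⟨by simpa using hx 0 le_rfl, hxlip.lipschitzOnWith⟩, fun t ht => ?_⟩
    rw [hx t ht.1]
    congr 1
    refine intervalIntegral.integral_congr_ae ?_
    filter_upwards [(ae_restrict_iff' measurableSet_Icc).1 huc] with s hs hst
    rw [uIoc_of_le ht.1] at hst
    rw [hs ⟨hst.1.le, hst.2.trans ht.2⟩]

theorem isSolution_systemMap (x₀ : Vec n) {u : Signal m} (hu : P.IsControl u.dur u.val) :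
    P.IsSolution x₀ u (P.systemMap x₀ u) :=
  Classical.epsilon_spec (hP.exists_isSolution x₀ hu)

theorem continuousOn_systemMap (x₀ : Vec n) {u : Signal m} (hu : P.IsControl u.dur u.val) :
    ContinuousOn (P.systemMap x₀ u) (Icc 0 u.dur) :=
  (hP.isSolution_systemMap x₀ hu).1.2.continuousOn

/-- The solution of the integral equation is unique. -/
theorem eqOn_of_integral_eq {τ : ℝ} {c : ℝ → Vec m} {x y : ℝ → Vec n} {x₀ : Vec n} (hτ : 0 ≤ τ)
    (hc : P.IsControl τ c) (hx : ContinuousOn x (Icc 0 τ)) (hy : ContinuousOn y (Icc 0 τ))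
    (hx' : ∀ t ∈ Icc 0 τ, x t = x₀ + ∫ s in (0 : ℝ)..t, P.f (x s) (c s))
    (hy' : ∀ t ∈ Icc 0 τ, y t = x₀ + ∫ s in (0 : ℝ)..t, P.f (y s) (c s)) :
    EqOn x y (Icc 0 τ) := by
  intro t ht
  have := norm_sub_le_of_integral_eq (β := fun _ => 0) hτ hP.Lf_pos.le hx hy hx' hy'
    (hP.intervalIntegrable_f hτ hc hx) (hP.intervalIntegrable_f hτ hc hy)
    intervalIntegrable_const (Eventually.of_forall fun _ => le_rfl)
    (by filter_upwards [hc.2] with s hs; simpa using hP.f_lipschitz _ hs (x s) (y s)) t ht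
  simpa [sub_eq_zero] using this

end Assumptions

end Problem

/-! ### Trajectories of strings. -/

section Words

variable {n m : ℕ} {P : Problem n m} {uMax Lg Lf : ℝ} {R : ℕ}

theorem Word.signal_val_of_floor_eq {w : Word m} {i : ℕ} {t : ℝ} (hi : i < w.length)
    (h : ⌊t * (R : ℝ)⌋₊ = i) : (w.signal R).val t = w[i] := by
  have : min i (w.length - 1) = i := by omega
  simp [Word.signal, h, this, hi]

theorem floor_mul_eq_of_mem_Ico (hR : 1 ≤ R) {i : ℕ} {t : ℝ} (ht : t ∈ Ico 0 (1 / (R : ℝ))) :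
    ⌊((i : ℝ) / R + t) * (R : ℝ)⌋₊ = i := by
  have hR' : (0 : ℝ) < R := by exact_mod_cast hR
  have h1 : ((i : ℝ) / R + t) * R = i + t * R := by field_simp
  have h2 : t * R < 1 := by have := ht.2; rwa [lt_div_iff₀ hR'] at this
  have h3 : 0 ≤ t * R := mul_nonneg ht.1 hR'.le
  rw [h1, Nat.floor_eq_iff (by positivity)]
  constructor <;> linarith

theorem Word.signal_dur_nonneg (w : Word m) : 0 ≤ (w.signal R).dur := by
  simp only [Word.signal]; positivity

theorem Word.signal_val_mem {w : Word m} (hw : w ≠ []) (t : ℝ) : (w.signal R).val t ∈ w := by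
  have hlen : 0 < w.length := List.length_pos_iff.2 hw
  have : min ⌊t * (R : ℝ)⌋₊ (w.length - 1) < w.length := by omega
  simp only [Word.signal, List.getD_eq_getElem _ _ this, List.getElem_mem]

theorem Word.measurable_signal_val (w : Word m) : Measurable (w.signal R).val :=
  (measurable_from_nat (f := fun i => w.getD (min i (w.length - 1)) 0)).comp
    (Nat.measurable_floor.comp (measurable_id.mul_const _))

theorem Word.isControl {w : Word m} (hw : ∀ v ∈ w, v ∈ P.Ω) :
    P.IsControl (w.signal R).dur (w.signal R).val := by
  refine ⟨w.measurable_signal_val.aestronglyMeasurable, ?_⟩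
  rcases eq_or_ne w [] with rfl | h
  · simp [Word.signal]
  · exact Eventually.of_forall fun t => hw _ (Word.signal_val_mem h t)

theorem Word.signal_mem_signalSpace (hP : P.Assumptions uMax Lg Lf) (hR : 1 ≤ R) {w : Word m}
    (hw : ∀ v ∈ w, v ∈ P.Ω) (hne : w ≠ []) : w.signal R ∈ P.signalSpace := by
  have hlen : 0 < w.length := List.length_pos_iff.2 hne
  refine ⟨?_, ?_, fun t _ => hw _ (Word.signal_val_mem hne t)⟩
  · simp only [Word.signal]; positivity
  · exact Measure.integrableOn_of_bounded (M := uMax) (by simp)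
      w.measurable_signal_val.aestronglyMeasurable
      (Eventually.of_forall fun t => hP.norm_le_of_mem _ (hw _ (Word.signal_val_mem hne t)))

variable (hP : P.Assumptions uMax Lg Lf)
include hP

/-- The trajectory of a string coincides with that of its prefixes. -/
theorem Word.systemMap_append {z s : Word m} (hR : 1 ≤ R) (hz : ∀ v ∈ z, v ∈ P.Ω)
    (hs : ∀ v ∈ s, v ∈ P.Ω) :
    EqOn (P.systemMap P.xIc ((z ++ s).signal R)) (P.systemMap P.xIc (z.signal R))
      (Icc 0 ((z.length : ℝ) / R)) := by
  have hR' : (0 : ℝ) < R := by exact_mod_cast hR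
  have hzc := Word.isControl (R := R) hz
  have hzs : ∀ v ∈ z ++ s, v ∈ P.Ω := fun v hv => (List.mem_append.1 hv).elim (hz v) (hs v)
  have hzsc := Word.isControl (R := R) hzs
  have hle : (z.length : ℝ) / R ≤ ((z ++ s).signal R).dur := by
    simp only [Word.signal, List.length_append, Nat.cast_add]
    gcongr
    simp
  have hsol := hP.isSolution_systemMap P.xIc hzc
  have hsol' := hP.isSolution_systemMap P.xIc hzsc
  refine hP.eqOn_of_integral_eq (x₀ := P.xIc) (c := (z.signal R).val) (by positivity) hzc
    (hsol'.1.2.continuousOn.mono (Icc_subset_Icc_right hle)) hsol.1.2.continuousOn ?_ hsol.2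
  intro t ht
  rw [hsol'.2 t ⟨ht.1, ht.2.trans hle⟩]
  congr 1
  refine intervalIntegral.integral_congr_ae ?_
  -- The time |z|/R is dropped: there z still has its last letter, while z ++ s may already have
  -- moved on to the next one.
  filter_upwards [Measure.ae_ne volume ((z.length : ℝ) / R)] with r hr hrt
  rw [uIoc_of_le ht.1] at hrt
  have hlt : r < z.length / R := lt_of_le_of_ne (hrt.2.trans ht.2) hr
  have hfl : ⌊r * (R : ℝ)⌋₊ < z.length := by
    rw [Nat.floor_lt (mul_nonneg hrt.1.le hR'.le)]
    rwa [lt_div_iff₀ hR'] at hlt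
  rw [Word.signal_val_of_floor_eq hfl rfl,
    Word.signal_val_of_floor_eq (by simp; omega : ⌊r * (R : ℝ)⌋₊ < (z ++ s).length) rfl,
    List.getElem_append_left hfl]

omit hP in
theorem Word.add_mem_Icc {w : Word m} {i : ℕ} (hi : i < w.length) {t : ℝ}
    (ht : t ∈ Icc 0 (1 / (R : ℝ))) : (i : ℝ) / R + t ∈ Icc 0 (w.signal R).dur := by
  refine ⟨add_nonneg (by positivity) ht.1, ?_⟩
  have h1 : ((i : ℝ) + 1) / R ≤ w.length / R := by
    gcongr; exact_mod_cast hi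
  have := ht.2
  rw [add_div] at h1
  simp only [Word.signal]
  linarith

omit hP in
/-- Integrals over one step of a string. -/
theorem Word.integral_step {F : Type*} [NormedAddCommGroup F] [NormedSpace ℝ F]
    (H : ℝ → Vec m → F) {w : Word m} (hR : 1 ≤ R) {i : ℕ} (hi : i < w.length) {t : ℝ}
    (ht : t ∈ Icc 0 (1 / (R : ℝ))) :
    ∫ s in ((i : ℝ) / R)..((i : ℝ) / R + t), H s ((w.signal R).val s)
      = ∫ s in (0 : ℝ)..t, H ((i : ℝ) / R + s) w[i] := by
  have := intervalIntegral.integral_comp_add_left (a := 0) (b := t)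
    (fun s => H s ((w.signal R).val s)) ((i : ℝ) / R)
  rw [add_zero] at this
  rw [← this]
  refine intervalIntegral.integral_congr_ae ?_
  filter_upwards [Measure.ae_ne volume (1 / (R : ℝ))] with r hr hrt
  rw [uIoc_of_le ht.1] at hrt
  rw [Word.signal_val_of_floor_eq hi
    (floor_mul_eq_of_mem_Ico hR ⟨hrt.1.le, lt_of_le_of_ne (hrt.2.trans ht.2) hr⟩)]

/-- The integral equation restarted at the grid time i/R, with the control frozen at one letter.
Strings of different lengths can then be compared step by step, although their steps happen at
different times. -/
theorem Word.systemMap_step {w : Word m} (hR : 1 ≤ R) (hw : ∀ v ∈ w, v ∈ P.Ω) {i : ℕ}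
    (hi : i < w.length) {t : ℝ} (ht : t ∈ Icc 0 (1 / (R : ℝ))) :
    P.systemMap P.xIc (w.signal R) ((i : ℝ) / R + t)
      = P.systemMap P.xIc (w.signal R) ((i : ℝ) / R)
        + ∫ s in (0 : ℝ)..t, P.f (P.systemMap P.xIc (w.signal R) ((i : ℝ) / R + s)) w[i] := by
  have hc := Word.isControl (R := R) hw
  have hsol := hP.isSolution_systemMap P.xIc hc
  have hint := hP.intervalIntegrable_f w.signal_dur_nonneg hc hsol.1.2.continuousOn
  have m1 := Word.add_mem_Icc hi ht
  have m2 := Word.add_mem_Icc (R := R) hi (t := 0) ⟨le_rfl, by positivity⟩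
  rw [add_zero] at m2
  have hsub : ∀ {a}, a ∈ Icc 0 (w.signal R).dur → uIcc 0 a ⊆ uIcc 0 (w.signal R).dur := by
    intro a ha
    rw [uIcc_of_le ha.1, uIcc_of_le w.signal_dur_nonneg]
    exact Icc_subset_Icc_right ha.2
  rw [← Word.integral_step (fun s => P.f (P.systemMap P.xIc (w.signal R) s)) hR hi ht]
  rw [hsol.2 _ m1, hsol.2 _ m2, ← intervalIntegral.integral_add_adjacent_intervals
    (hint.mono_set (hsub m2)) ((hint.mono_set (hsub m2)).symm.trans (hint.mono_set (hsub m1))),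
    add_assoc]

end Words

end GLC

namespace GLC

open MeasureTheory Set Filter Topology

/-! ### Extending a string by one letter of a reference string. -/

section Extension

variable {n m : ℕ} {P : Problem n m} {uMax Lg Lf : ℝ} {R : ℕ}

/-- The cost of the first `i` steps of a string. -/
noncomputable def Word.partialCost (P : Problem n m) (R : ℕ) (w : Word m) (i : ℕ) : ℝ :=
  ∫ t in (0 : ℝ)..((i : ℝ) / R), P.g (P.systemMap P.xIc (w.signal R) t) ((w.signal R).val t)

theorem Word.partialCost_length (w : Word m) :
    w.partialCost P R w.length = P.cost P.xIc (w.signal R) := rfl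

theorem Word.div_mem_Icc {w : Word m} {i : ℕ} (hi : i ≤ w.length) :
    (i : ℝ) / R ∈ Icc 0 (w.signal R).dur := by
  refine ⟨by positivity, ?_⟩
  simp only [Word.signal]
  gcongr

theorem Word.uIcc_subset_of_mem {w : Word m} {a : ℝ} (ha : a ∈ Icc 0 (w.signal R).dur) :
    uIcc 0 a ⊆ uIcc 0 (w.signal R).dur := by
  rw [uIcc_of_le ha.1, uIcc_of_le w.signal_dur_nonneg]
  exact Icc_subset_Icc_right ha.2

variable (hP : P.Assumptions uMax Lg Lf)
include hP

theorem Word.intervalIntegrable_g {w : Word m} (hw : ∀ v ∈ w, v ∈ P.Ω)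
    (hfree : ∀ t ∈ Icc 0 (w.signal R).dur, P.systemMap P.xIc (w.signal R) t ∈ P.Xfree) :
    IntervalIntegrable (fun t => P.g (P.systemMap P.xIc (w.signal R) t) ((w.signal R).val t))
      volume 0 (w.signal R).dur :=
  hP.intervalIntegrable_g w.signal_dur_nonneg (Word.isControl hw)
    (hP.continuousOn_systemMap _ (Word.isControl hw)) hfree

theorem Word.partialCost_succ {w : Word m} (hR : 1 ≤ R) (hw : ∀ v ∈ w, v ∈ P.Ω)
    (hfree : ∀ t ∈ Icc 0 (w.signal R).dur, P.systemMap P.xIc (w.signal R) t ∈ P.Xfree)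
    {i : ℕ} (hi : i < w.length) :
    w.partialCost P R (i + 1) = w.partialCost P R i
      + ∫ s in (0 : ℝ)..(1 / R), P.g (P.systemMap P.xIc (w.signal R) ((i : ℝ) / R + s)) w[i] := by
  have hint := Word.intervalIntegrable_g hP hw hfree
  have e : (((i + 1 : ℕ) : ℝ)) / R = (i : ℝ) / R + 1 / R := by push_cast; ring
  have m1 := Word.div_mem_Icc (R := R) hi.le
  have m2 := Word.div_mem_Icc (R := R) (Nat.succ_le_of_lt hi)
  have h0 := hint.mono_set (Word.uIcc_subset_of_mem m1)
  have h1 := hint.mono_set (Word.uIcc_subset_of_mem m2)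
  rw [← Word.integral_step (fun s => P.g (P.systemMap P.xIc (w.signal R) s)) hR hi
    ⟨by positivity, le_rfl⟩, ← e]
  exact (intervalIntegral.integral_add_adjacent_intervals h0 (h0.symm.trans h1)).symm

theorem Word.partialCost_mono {w : Word m} (hw : ∀ v ∈ w, v ∈ P.Ω)
    (hfree : ∀ t ∈ Icc 0 (w.signal R).dur, P.systemMap P.xIc (w.signal R) t ∈ P.Xfree)
    {i : ℕ} (hi : i ≤ w.length) : w.partialCost P R i ≤ P.cost P.xIc (w.signal R) := by
  have m := Word.div_mem_Icc (R := R) hi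
  refine intervalIntegral.integral_mono_interval le_rfl m.1 m.2 ?_
    (Word.intervalIntegrable_g hP hw hfree)
  refine ae_restrict_of_ae_restrict_of_subset Ioc_subset_Icc_self ?_
  filter_upwards [(Word.isControl (R := R) hw).2, ae_restrict_mem measurableSet_Icc] with s h1 h2
  exact (hP.g_pos _ (hfree s h2) _ h1).le

/-- The prefix has the same trajectory and almost everywhere the same control, so an extension pays
only for its new steps. -/
theorem Word.partialCost_append {z s : Word m} (hR : 1 ≤ R) (hz : ∀ v ∈ z, v ∈ P.Ω)
    (hs : ∀ v ∈ s, v ∈ P.Ω) :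
    (z ++ s).partialCost P R z.length = P.cost P.xIc (z.signal R) := by
  have hR' : (0 : ℝ) < R := by exact_mod_cast hR
  have h0 : (0 : ℝ) ≤ (z.length : ℝ) / R := by positivity
  refine intervalIntegral.integral_congr_ae ?_
  filter_upwards [Measure.ae_ne volume ((z.length : ℝ) / R)] with r hr hrt
  rw [uIoc_of_le h0] at hrt
  have hlt : r < z.length / R := lt_of_le_of_ne hrt.2 hr
  have hfl : ⌊r * (R : ℝ)⌋₊ < z.length := by
    rw [Nat.floor_lt (mul_nonneg hrt.1.le hR'.le)]
    rwa [lt_div_iff₀ hR'] at hlt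
  rw [Word.signal_val_of_floor_eq hfl rfl,
    Word.signal_val_of_floor_eq (by simp; omega : ⌊r * (R : ℝ)⌋₊ < (z ++ s).length) rfl,
    List.getElem_append_left hfl, Word.systemMap_append hP hR hz hs ⟨hrt.1.le, hrt.2⟩]

/-- Two strings extended by the same letter: the distance of the trajectories during the last
step. -/
theorem Word.norm_systemMap_extend_sub_le {w z : Word m} (hR : 1 ≤ R) (hw : ∀ v ∈ w, v ∈ P.Ω)
    (hz : ∀ v ∈ z, v ∈ P.Ω) {k : ℕ} (hk : k < w.length) {t : ℝ} (ht : t ∈ Icc 0 (1 / (R : ℝ))) :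
    ‖P.systemMap P.xIc ((z ++ [w[k]]).signal R) ((z.length : ℝ) / R + t)
        - P.systemMap P.xIc (w.signal R) ((k : ℝ) / R + t)‖
      ≤ ‖P.terminalState (z.signal R) - P.systemMap P.xIc (w.signal R) ((k : ℝ) / R)‖
        * Real.exp (Lf / R) := by
  have hv : w[k] ∈ P.Ω := hw _ (List.getElem_mem hk)
  have hzv : ∀ v ∈ z ++ [w[k]], v ∈ P.Ω := fun v hv' =>
    (List.mem_append.1 hv').elim (hz v) fun h => by rw [List.mem_singleton.1 h]; exact hv
  have hlen : z.length < (z ++ [w[k]]).length := by simp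
  have h0 : (0 : ℝ) ≤ 1 / R := by positivity
  have hcont : ∀ {a : Word m} {i : ℕ}, (∀ v ∈ a, v ∈ P.Ω) → i < a.length →
      ContinuousOn (fun s => P.systemMap P.xIc (a.signal R) ((i : ℝ) / R + s))
        (Icc 0 (1 / (R : ℝ))) := fun ha hi =>
    (hP.continuousOn_systemMap P.xIc (Word.isControl ha)).comp (by fun_prop)
      fun s hs => Word.add_mem_Icc hi hs
  have hctrl : P.IsControl (1 / (R : ℝ)) (fun _ => w[k]) :=
    ⟨aestronglyMeasurable_const, Eventually.of_forall fun _ => hv⟩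
  have hp : P.systemMap P.xIc ((z ++ [w[k]]).signal R) ((z.length : ℝ) / R)
      = P.terminalState (z.signal R) :=
    Word.systemMap_append hP hR hz (by simpa using hv) ⟨by positivity, le_rfl⟩
  have hlast : (z ++ [w[k]])[z.length] = w[k] := by simp
  -- Both steps use the same letter, so there is no forcing term and the initial error is only
  -- amplified.
  have key := norm_sub_le_of_integral_eq (β := fun _ => 0) h0 hP.Lf_pos.le
    (hcont hzv hlen) (hcont hw hk)
    (fun t ht => Word.systemMap_step hP hR hzv hlen ht)
    (fun t ht => Word.systemMap_step hP hR hw hk ht)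
    (by simpa only [hlast] using hP.intervalIntegrable_f h0 hctrl (hcont hzv hlen))
    (hP.intervalIntegrable_f h0 hctrl (hcont hw hk))
    intervalIntegrable_const (Eventually.of_forall fun _ => le_rfl)
    (Eventually.of_forall fun s => by simpa only [hlast, add_zero] using hP.f_lipschitz _ hv _ _)
    t ht
  rw [hp, intervalIntegral.integral_zero, add_zero] at key
  refine key.trans ?_
  have h1 : Lf * t ≤ Lf / R := by
    have := mul_le_mul_of_nonneg_left ht.2 hP.Lf_pos.le
    rwa [mul_one_div] at this
  gcongr

/-- A string near a reference trajectory with clearance, extended by the next letter of the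
reference string, is free and has nearly the same increment of the cost. -/
theorem Word.extend_mem_freeSignals {w z : Word m} (hR : 1 ≤ R) (hw : ∀ v ∈ w, v ∈ P.Ω)
    (hz : ∀ v ∈ z, v ∈ P.Ω) (hzfree : z = [] ∨ z.signal R ∈ P.freeSignals) {δ D : ℝ}
    (hclear : ∀ t ∈ Icc 0 (w.signal R).dur, ∀ y,
      ‖y - P.systemMap P.xIc (w.signal R) t‖ ≤ δ → y ∈ P.Xfree)
    {k : ℕ} (hk : k < w.length)
    (hD : ‖P.terminalState (z.signal R) - P.systemMap P.xIc (w.signal R) ((k : ℝ) / R)‖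
        * Real.exp (Lf / R) ≤ D) (hDδ : D ≤ δ) :
    (z ++ [w[k]]).signal R ∈ P.freeSignals ∧
      P.cost P.xIc ((z ++ [w[k]]).signal R) ≤ P.cost P.xIc (z.signal R)
        + (w.partialCost P R (k + 1) - w.partialCost P R k) + |Lg| * D / R := by
  have hv : w[k] ∈ P.Ω := hw _ (List.getElem_mem hk)
  have hzv : ∀ v ∈ z ++ [w[k]], v ∈ P.Ω := fun v hv' =>
    (List.mem_append.1 hv').elim (hz v) fun h => by rw [List.mem_singleton.1 h]; exact hv
  have hlen : z.length < (z ++ [w[k]]).length := by simp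
  have h0 : (0 : ℝ) ≤ 1 / R := by positivity
  have hD0 : 0 ≤ D := le_trans (by positivity) hD
  have hnear : ∀ t ∈ Icc 0 (1 / (R : ℝ)),
      ‖P.systemMap P.xIc ((z ++ [w[k]]).signal R) ((z.length : ℝ) / R + t)
        - P.systemMap P.xIc (w.signal R) ((k : ℝ) / R + t)‖ ≤ D := fun t ht =>
    (Word.norm_systemMap_extend_sub_le hP hR hw hz hk ht).trans hD
  have hwfree : ∀ t ∈ Icc 0 (w.signal R).dur, P.systemMap P.xIc (w.signal R) t ∈ P.Xfree :=
    fun t ht => hclear t ht _ (by rw [sub_self, norm_zero]; exact hD0.trans hDδ)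
  have hlastfree : ∀ t ∈ Icc 0 (1 / (R : ℝ)),
      P.systemMap P.xIc ((z ++ [w[k]]).signal R) ((z.length : ℝ) / R + t) ∈ P.Xfree := fun t ht =>
    hclear _ (Word.add_mem_Icc hk ht) _ ((hnear t ht).trans hDδ)
  have hdur : ((z ++ [w[k]]).signal R).dur = (z.length : ℝ) / R + 1 / R := by
    simp [Word.signal, add_div]
  have hfree : ∀ t ∈ Icc 0 ((z ++ [w[k]]).signal R).dur,
      P.systemMap P.xIc ((z ++ [w[k]]).signal R) t ∈ P.Xfree := by
    intro t ht
    rcases lt_or_ge t ((z.length : ℝ) / R) with h | h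
    -- Before the last step the trajectory is that of z; for the root this part is empty.
    · rw [Word.systemMap_append hP hR hz (by simpa using hv) ⟨ht.1, h.le⟩]
      rcases hzfree with rfl | hzf
      · simp only [List.length_nil, Nat.cast_zero, zero_div] at h
        exact absurd h (not_lt.2 ht.1)
      · exact hzf.2 t ⟨ht.1, h.le⟩
    · have := hlastfree (t - (z.length : ℝ) / R) ⟨by linarith, by rw [hdur] at ht; linarith [ht.2]⟩
      rwa [add_sub_cancel] at this
  refine ⟨⟨Word.signal_mem_signalSpace hP hR hzv (by simp), hfree⟩, ?_⟩
  have hcont : ∀ {a : Word m} {i : ℕ}, (∀ v ∈ a, v ∈ P.Ω) → i < a.length →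
      ContinuousOn (fun s => P.systemMap P.xIc (a.signal R) ((i : ℝ) / R + s))
        (Icc 0 (1 / (R : ℝ))) := fun ha hi =>
    (hP.continuousOn_systemMap P.xIc (Word.isControl ha)).comp (by fun_prop)
      fun s hs => Word.add_mem_Icc hi hs
  have hctrl : P.IsControl (1 / (R : ℝ)) (fun _ => w[k]) :=
    ⟨aestronglyMeasurable_const, Eventually.of_forall fun _ => hv⟩
  have i1 := hP.intervalIntegrable_g h0 hctrl (hcont hzv hlen) hlastfree
  have i2 := hP.intervalIntegrable_g h0 hctrl (hcont hw hk)
    fun t ht => hwfree _ (Word.add_mem_Icc hk ht)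
  have e1 := Word.partialCost_succ hP hR hzv hfree hlen
  have e2 := Word.partialCost_succ hP hR hw hwfree hk
  have hlast : (z ++ [w[k]])[z.length] = w[k] := by simp
  rw [hlast, Word.partialCost_append hP hR hz (by simpa using hv)] at e1
  have e3 : (z ++ [w[k]]).partialCost P R (z.length + 1)
      = P.cost P.xIc ((z ++ [w[k]]).signal R) := by
    rw [← Word.partialCost_length, List.length_append, List.length_singleton]
  rw [e3] at e1
  -- With equal letters the integrands differ by at most |Lg| D, over a step of length 1/R.
  have hle := intervalIntegral.integral_mono_on h0 i1 (i2.add (intervalIntegrable_const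
    (c := |Lg| * D))) fun s hs => by
      have := hP.abs_g_sub_le (hlastfree s hs) (hwfree _ (Word.add_mem_Icc hk hs)) hv hv
      rw [sub_self, norm_zero, add_zero] at this
      have h2 := mul_le_mul_of_nonneg_left (hnear s hs) (abs_nonneg Lg)
      have h3 := le_abs_self
        (P.g (P.systemMap P.xIc ((z ++ [w[k]]).signal R) ((z.length : ℝ) / R + s)) w[k]
          - P.g (P.systemMap P.xIc (w.signal R) ((k : ℝ) / R + s)) w[k])
      show _ ≤ P.g (P.systemMap P.xIc (w.signal R) ((k : ℝ) / R + s)) w[k] + |Lg| * D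
      linarith
  rw [intervalIntegral.integral_add i2 intervalIntegrable_const, intervalIntegral.integral_const,
    smul_eq_mul, sub_zero, one_div_mul_eq_div] at hle
  rw [e1, e2]
  linarith

end Extension

/-! ### Diameter of the partition cells. -/

section Cells

variable {n m : ℕ} {P : Problem n m} {T : Params m} {R : ℕ}

/-- Equivalent states are close. -/
theorem StateEquiv.norm_sub_le {p q : Vec n} (hη : 0 < T.η R) (h : StateEquiv T R p q) :
    ‖p - q‖ ≤ Real.sqrt n / T.η R := by
  have hi : ∀ i, ‖(p - q) i‖ ≤ 1 / T.η R := fun i => by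
    have h1 := Int.abs_sub_lt_one_of_floor_eq_floor (h i)
    rw [← mul_sub, abs_mul, abs_of_pos hη] at h1
    rw [PiLp.sub_apply, Real.norm_eq_abs, le_div_iff₀' hη]
    exact h1.le
  rw [EuclideanSpace.norm_eq, div_eq_mul_inv, ← Real.sqrt_sq (inv_nonneg.2 hη.le),
    ← Real.sqrt_mul (Nat.cast_nonneg n)]
  refine Real.sqrt_le_sqrt ?_
  calc ∑ i, ‖(p - q) i‖ ^ 2 ≤ ∑ _i : Fin n, (T.η R)⁻¹ ^ 2 :=
        Finset.sum_le_sum fun i _ => pow_le_pow_left₀ (norm_nonneg _) (by simpa using hi i) 2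
    _ = n * (T.η R)⁻¹ ^ 2 := by simp

end Cells

end GLC

namespace GLC

open Set Filter Topology

/-! ### Termination. -/

section Termination

variable {n m : ℕ} {P : Problem n m} {T : Params m} {R : ℕ}

theorem mem_expand {u w : Word m} (hw : w ∈ expand T R u) :
    ∃ v ∈ T.Ω R, w = u ++ [v] ∧ u.length + 1 ≤ T.h R := by
  obtain ⟨⟨-, hlen, hΩ⟩, v, rfl⟩ := hw
  exact ⟨v, hΩ v (by simp), rfl, by simpa using hlen⟩

theorem expand_subset_image (u : Word m) :
    expand T R u ⊆ (fun v => u ++ [v]) '' (T.Ω R : Set (Vec m)) := fun _ hw => by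
  obtain ⟨v, hv, rfl, -⟩ := mem_expand hw
  exact ⟨v, hv, rfl⟩

theorem finite_expand (u : Word m) : (expand T R u).Finite :=
  ((T.Ω R).finite_toSet.image _).subset (expand_subset_image u)

theorem exists_isFind (L : Set (Word m)) (w : Word m) : ∃ z, IsFind P T R L w z := by
  by_cases h : ∃ z ∈ L, WordEquiv P T R w z
  · obtain ⟨z, hz, hwz⟩ := h
    exact ⟨some z, hz, hwz⟩
  · push Not at h
    exact ⟨none, h⟩

theorem exists_forLoop (l : List (Word m)) (S L : Set (Word m)) :
    ∃ S' L', ForLoop P T R l S L S' L' := by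
  induction l generalizing S L with
  | nil => exact ⟨S, L, .nil S L⟩
  | cons w l ih =>
    obtain ⟨z, hz⟩ := exists_isFind (P := P) (T := T) (R := R) L w
    by_cases hd : Discard P T R w z
    · obtain ⟨S', L', h⟩ := ih (S \ {w}) L
      exact ⟨S', L', .discard hz hd h⟩
    · by_cases hi : Improves P R w z
      · obtain ⟨S', L', h⟩ := ih S ((L \ {z' | z = some z'}) ∪ {w})
        exact ⟨S', L', .relabel hz hd hi h⟩
      · obtain ⟨S', L', h⟩ := ih S L
        exact ⟨S', L', .keep hz hd hi h⟩

theorem ForLoop.subset {l : List (Word m)} {S L S' L' : Set (Word m)}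
    (h : ForLoop P T R l S L S' L') : S' ⊆ S := by
  induction h with
  | nil => exact Subset.rfl
  | discard _ _ _ ih => exact ih.trans sdiff_subset
  | relabel _ _ _ _ ih => exact ih
  | keep _ _ _ _ ih => exact ih

/-- A bound for the number of nodes that can still be expanded from the queue. -/
def potential (T : Params m) (R : ℕ) (F : Finset (Word m)) : ℕ :=
  ∑ q ∈ F, ((T.Ω R).card + 1) ^ (T.h R - q.length)

/-- With N = |Ω_R| and e + 1 = h - |u|, the children weigh at most N(N+1)^e < (N+1)^(e+1). The base
N + 1 makes this strict, and a string without retained children still gives up a positive weight. -/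
theorem potential_lt_of_subset_expand {u : Word m} {F : Finset (Word m)}
    (hF : (F : Set (Word m)) ⊆ expand T R u) :
    potential T R F < ((T.Ω R).card + 1) ^ (T.h R - u.length) := by
  classical
  rcases F.eq_empty_or_nonempty with rfl | ⟨q, hq⟩
  · simp [potential]
  obtain ⟨-, -, -, hu⟩ := mem_expand (hF hq)
  have hcard : F.card ≤ (T.Ω R).card := by
    refine (Finset.card_le_card (t := (T.Ω R).image fun v => u ++ [v]) ?_).trans
      Finset.card_image_le
    rw [← Finset.coe_subset, Finset.coe_image]
    exact hF.trans (expand_subset_image u)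
  have hsum : potential T R F = F.card * ((T.Ω R).card + 1) ^ (T.h R - u.length - 1) := by
    rw [potential, Finset.sum_const_nat]
    intro w hw
    obtain ⟨v, -, rfl, -⟩ := mem_expand (hF hw)
    simp [Nat.sub_sub]
  obtain ⟨e, he⟩ : ∃ e, T.h R - u.length = e + 1 := ⟨T.h R - u.length - 1, by omega⟩
  rw [hsum, he, Nat.add_sub_cancel, pow_succ']
  exact Nat.mul_lt_mul_of_pos_right (by omega) (by positivity)

/-- Besides the descent, this shows that the queue stays finite, which is what provides an element
of least cost for the next pop. -/
theorem Step.exists_potential_lt {F : Finset (Word m)} {L Q' L' : Set (Word m)}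
    (h : Step P T R (.running F L) (.running Q' L')) :
    ∃ F' : Finset (Word m), Q' = F' ∧ potential T R F' < potential T R F := by
  classical
  generalize hQ : (F : Set (Word m)) = Q at h
  cases h with
  | @expand _ _ S' _ u l hpop hgoal hnodup hmem hloop =>
    have hS : S'.Finite := (finite_expand u).subset hloop.subset
    subst hQ
    have hu : u ∈ F := hpop.1
    refine ⟨F.erase u ∪ hS.toFinset, by simp, ?_⟩
    have h1 : potential T R (F.erase u ∪ hS.toFinset)
        ≤ potential T R (F.erase u) + potential T R hS.toFinset := by
      rw [potential, potential, potential, ← Finset.sum_union_inter]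
      exact Nat.le_add_right _ _
    have h2 := potential_lt_of_subset_expand (T := T) (R := R) (u := u) (F := hS.toFinset)
      (by simpa using hloop.subset)
    have h3 := Finset.sum_erase_add F (fun q => ((T.Ω R).card + 1) ^ (T.h R - q.length)) hu
    simp only [potential] at *
    omega

theorem exists_step {F : Finset (Word m)} (L : Set (Word m)) :
    ∃ c, Step P T R (.running F L) c := by
  classical
  rcases F.eq_empty_or_nonempty with rfl | hne
  · exact ⟨_, by simpa using Step.fail L⟩
  · obtain ⟨u, hu, hmin⟩ := F.exists_min_image (fun w => P.cost P.xIc (w.signal R)) hne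
    have hpop : IsPop P R (F : Set (Word m)) u := ⟨hu, hmin⟩
    by_cases hg : u.signal R ∈ P.goalSignals
    · exact ⟨_, .goal hpop hg⟩
    · obtain ⟨S', L', h⟩ := exists_forLoop (P := P) (T := T) (R := R)
        (finite_expand (T := T) (R := R) u).toFinset.toList (expand T R u) L
      exact ⟨_, .expand hpop hg (Finset.nodup_toList _) (by simp) h⟩

theorem not_step_returned {out : Option (Signal m)} {c : Config m} :
    ¬ Step P T R (.returned out) c := fun h => by cases h

theorem terminates : Terminates P T R := by
  constructor
  · rintro ⟨c, h0, hstep⟩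
    have hrun : ∀ k, ∃ (Q L : Set (Word m)), c k = .running Q L := fun k => by
      cases hk : c k with
      | running Q L => exact ⟨Q, L, rfl⟩
      | returned out => exact absurd (hk ▸ hstep k) not_step_returned
    have key : ∀ k, ∃ (F : Finset (Word m)) (L : Set (Word m)), c k = .running F L ∧
        potential T R F + k ≤ potential T R {([] : Word m)} := by
      intro k
      induction k with
      | zero => exact ⟨{[]}, ∅, by simp [h0, initial], by simp⟩
      | succ k ih =>
        obtain ⟨F, L, hF, hle⟩ := ih
        obtain ⟨Q', L', hQ⟩ := hrun (k + 1)
        have hs := hstep k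
        rw [hF, hQ] at hs
        obtain ⟨F', rfl, hlt⟩ := hs.exists_potential_lt
        exact ⟨F', L', hQ, by omega⟩
    obtain ⟨F, L, -, hle⟩ := key (potential T R {([] : Word m)} + 1)
    omega
  · intro c hc
    have key : (∃ out, c = .returned out) ∨ ∃ (F : Finset (Word m)) (L : Set (Word m)),
        c = .running F L := by
      induction hc with
      | refl => exact .inr ⟨{[]}, ∅, by simp [initial]⟩
      | @tail b c _ hs ih =>
        rcases ih with ⟨out, rfl⟩ | ⟨F, L, rfl⟩
        · exact absurd hs not_step_returned
        · cases c with
          | returned out => exact .inl ⟨out, rfl⟩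
          | running Q L' =>
            obtain ⟨F', rfl, -⟩ := hs.exists_potential_lt
            exact .inr ⟨F', L', rfl⟩
    rcases key with h | ⟨F, L, rfl⟩
    · exact .inl h
    · exact .inr (exists_step L)

end Termination

/-! ### The invariant of the search. -/

section Invariant

variable {n m : ℕ} {P : Problem n m} {T : Params m} {R : ℕ}

/-- The loop removes only the child being processed. In a list without repetitions, a child once
kept is therefore kept for good. -/
theorem ForLoop.subset_union {l : List (Word m)} {S L S' L' : Set (Word m)}
    (h : ForLoop P T R l S L S' L') : S ⊆ S' ∪ {w | w ∈ l} := by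
  induction h with
  | nil => exact fun w hw => .inl hw
  | @discard w l z S L S' L' _ _ _ ih =>
    intro x hx
    by_cases hxw : x = w
    · exact .inr (by simp [hxw])
    · exact (ih ⟨hx, hxw⟩).imp_right fun h => List.mem_cons_of_mem _ h
  | relabel _ _ _ _ ih => exact fun x hx => (ih hx).imp_right fun h => List.mem_cons_of_mem _ h
  | keep _ _ _ _ ih => exact fun x hx => (ih hx).imp_right fun h => List.mem_cons_of_mem _ h

/-- The reasons for which a child `w` may be missing, `K` being the set of known strings. -/
def Pruned (P : Problem n m) (T : Params m) (R : ℕ) (K : Set (Word m)) (w : Word m) : Prop :=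
  w.signal R ∉ P.freeSignals ∨ T.h R ≤ w.length ∨ ∃ z ∈ K, z ≠ [] ∧ Prec P T R z w

theorem Pruned.mono {K K' : Set (Word m)} {w : Word m} (h : Pruned P T R K w) (hK : K ⊆ K') :
    Pruned P T R K' w :=
  h.imp_right fun h => h.imp_right fun ⟨z, hz, h⟩ => ⟨z, hK hz, h⟩

/-- A string becomes a label only when it is kept, and then it survives the rest of the loop. -/
theorem ForLoop.labels_subset {l : List (Word m)} {S L S' L' : Set (Word m)}
    (h : ForLoop P T R l S L S' L') (hnd : l.Nodup) (hlS : ∀ w ∈ l, w ∈ S) : L' ⊆ L ∪ S' := by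
  induction h with
  | nil => exact subset_union_left
  | @discard w l z S L S' L' _ _ _ ih =>
    rw [List.nodup_cons] at hnd
    exact ih hnd.2 fun x hx => ⟨hlS x (List.mem_cons_of_mem _ hx),
      fun hxw => hnd.1 (by rwa [← mem_singleton_iff.1 hxw])⟩
  | @relabel w l z S L S' L' _ _ _ hrest ih =>
    rw [List.nodup_cons] at hnd
    have hw : w ∈ S' := (hrest.subset_union (hlS w (by simp))).resolve_right hnd.1
    refine (ih hnd.2 fun x hx => hlS x (List.mem_cons_of_mem _ hx)).trans ?_
    rintro x ((hx | hx) | hx)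
    · exact .inl hx.1
    · exact .inr (by rwa [mem_singleton_iff.1 hx])
    · exact .inr hx
  | keep _ _ _ _ ih =>
    rw [List.nodup_cons] at hnd
    exact ih hnd.2 fun x hx => hlS x (List.mem_cons_of_mem _ hx)

/-- The label that blocks a child may itself be replaced later in the loop. It is an old label or a
child kept in this round, so the witness is sought in L ∪ S' and not in L'. -/
theorem ForLoop.mem_or_pruned {l : List (Word m)} {S L S' L' : Set (Word m)}
    (h : ForLoop P T R l S L S' L') (hnd : l.Nodup) (hlS : ∀ w ∈ l, w ∈ S)
    (hne : ∀ w ∈ L ∪ S, w ≠ []) : ∀ w ∈ l, w ∈ S' ∨ Pruned P T R (L ∪ S') w := by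
  induction h with
  | nil => simp
  | @discard w l z S L S' L' hfind hd hrest ih =>
    rw [List.nodup_cons] at hnd
    intro x hx
    rcases List.mem_cons.1 hx with rfl | hx
    · rcases hd with hd | ⟨z', hz, hd⟩ | hd
      · exact .inr (.inl hd)
      · subst hz
        exact .inr (.inr (.inr ⟨z', .inl hfind.1, hne z' (.inl hfind.1), hd⟩))
      · exact .inr (.inr (.inl hd))
    · exact ih hnd.2 (fun x hx => ⟨hlS x (List.mem_cons_of_mem _ hx),
        fun hxw => hnd.1 (by rwa [← mem_singleton_iff.1 hxw])⟩)
        (fun y hy => hne y (hy.imp_right fun h => h.1)) x hx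
  | @relabel w l z S L S' L' _ _ _ hrest ih =>
    rw [List.nodup_cons] at hnd
    have hw : w ∈ S' := (hrest.subset_union (hlS w (by simp))).resolve_right hnd.1
    intro x hx
    rcases List.mem_cons.1 hx with rfl | hx
    · exact .inl hw
    · refine (ih hnd.2 (fun x hx => hlS x (List.mem_cons_of_mem _ hx)) ?_ x hx).imp_right
        fun h => h.mono ?_
      · rintro y ((hy | hy) | hy)
        · exact hne y (.inl hy.1)
        · exact hne y (.inr (by rw [mem_singleton_iff.1 hy]; exact hlS w (by simp)))
        · exact hne y (.inr hy)
      · rintro y ((hy | hy) | hy)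
        · exact .inl hy.1
        · exact .inr (by rwa [mem_singleton_iff.1 hy])
        · exact .inr hy
  | @keep w l z S L S' L' _ _ _ hrest ih =>
    rw [List.nodup_cons] at hnd
    have hw : w ∈ S' := (hrest.subset_union (hlS w (by simp))).resolve_right hnd.1
    intro x hx
    rcases List.mem_cons.1 hx with rfl | hx
    · exact .inl hw
    · exact ih hnd.2 (fun x hx => hlS x (List.mem_cons_of_mem _ hx)) hne x hx

theorem ForLoop.mem_freeSignals {l : List (Word m)} {S L S' L' : Set (Word m)}
    (h : ForLoop P T R l S L S' L') : ∀ w ∈ l, w ∈ S' → w.signal R ∈ P.freeSignals := by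
  induction h with
  | nil => simp
  | @discard w l z S L S' L' _ _ hrest ih =>
    intro x hx hxS
    rcases List.mem_cons.1 hx with rfl | hx
    · exact absurd rfl (hrest.subset hxS).2
    · exact ih x hx hxS
  | @relabel w l z S L S' L' _ hk _ hrest ih =>
    intro x hx hxS
    rcases List.mem_cons.1 hx with rfl | hx
    · exact not_not.1 fun h => hk (.inl h)
    · exact ih x hx hxS
  | @keep w l z S L S' L' _ hk _ hrest ih =>
    intro x hx hxS
    rcases List.mem_cons.1 hx with rfl | hx
    · exact not_not.1 fun h => hk (.inl h)
    · exact ih x hx hxS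

/-- The state of the search: `C` is the set of the strings that have been expanded. -/
structure Explored (P : Problem n m) (T : Params m) (R : ℕ) (Q L C : Set (Word m)) : Prop where
  root_mem : [] ∈ Q ∪ C
  labels_subset : L ⊆ Q ∪ C
  labels_ne : ∀ w ∈ L, w ≠ []
  letters : ∀ w ∈ Q ∪ C, ∀ v ∈ w, v ∈ T.Ω R
  free : ∀ w ∈ Q ∪ C, w = [] ∨ w.signal R ∈ P.freeSignals
  not_goal : ∀ u ∈ C, u.signal R ∉ P.goalSignals
  children : ∀ u ∈ C, ∀ w ∈ expand T R u, w ∈ Q ∪ C ∨ Pruned P T R (Q ∪ C) w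

theorem explored_initial : Explored P T R {[]} ∅ ∅ where
  root_mem := by simp
  labels_subset := by simp
  labels_ne := by simp
  letters := by simp
  free := by simp
  not_goal := by simp
  children := by simp

/-- The popped string moves from the queue to the expanded ones, so Q ∪ C only grows. Hence a reason
for pruning stays valid even after its label has been replaced. -/
theorem Explored.step {Q L C Q' L' : Set (Word m)} (h : Explored P T R Q L C)
    (hs : Step P T R (.running Q L) (.running Q' L')) : ∃ C', Explored P T R Q' L' C' := by
  cases hs with
  | @expand _ _ S' _ u l hpop hgoal hnodup hmem hloop =>
    have hlS : ∀ w ∈ l, w ∈ expand T R u := fun w hw => (hmem w).1 hw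
    have hS' : ∀ w ∈ S', w ∈ expand T R u := fun w hw => hloop.subset hw
    have hL' := hloop.labels_subset hnodup hlS
    have hexp : ∀ w ∈ expand T R u, w ≠ [] := fun w hw => hw.1.1
    have hLne : ∀ w ∈ L ∪ expand T R u, w ≠ [] := fun w hw => hw.elim (h.labels_ne w) (hexp w)
    have hsub : Q ∪ C ⊆ (Q \ {u} ∪ S') ∪ (C ∪ {u}) := by
      rintro x (hx | hx)
      · by_cases hxu : x = u
        · exact .inr (.inr hxu)
        · exact .inl (.inl ⟨hx, hxu⟩)
      · exact .inr (.inl hx)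
    have hsubS : S' ⊆ (Q \ {u} ∪ S') ∪ (C ∪ {u}) := fun x hx => .inl (.inr hx)
    have hback : ∀ x ∈ (Q \ {u} ∪ S') ∪ (C ∪ {u}), x ∈ Q ∪ C ∨ x ∈ S' := by
      rintro x ((hx | hx) | (hx | hx))
      · exact .inl (.inl hx.1)
      · exact .inr hx
      · exact .inl (.inr hx)
      · exact .inl (.inl (by rw [mem_singleton_iff.1 hx]; exact hpop.1))
    refine ⟨C ∪ {u}, hsub h.root_mem, ?_, ?_, ?_, ?_, ?_, ?_⟩
    · exact hL'.trans (union_subset (h.labels_subset.trans hsub) hsubS)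
    · exact fun w hw => (hL' hw).elim (h.labels_ne w) fun hw => hexp w (hS' w hw)
    · exact fun w hw => (hback w hw).elim (h.letters w) fun hw => (hS' w hw).1.2.2
    · exact fun w hw => (hback w hw).elim (h.free w) fun hw =>
        .inr (hloop.mem_freeSignals w ((hmem w).2 (hS' w hw)) hw)
    · rintro w (hw | hw)
      · exact h.not_goal w hw
      · rwa [mem_singleton_iff.1 hw]
    · rintro w (hw | hw) x hx
      · exact (h.children w hw x hx).imp (fun h => hsub h) fun h => h.mono hsub
      · rw [mem_singleton_iff.1 hw] at hx
        exact (hloop.mem_or_pruned hnodup hlS hLne x ((hmem x).2 hx)).imp (fun h => hsubS h)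
          fun hp => hp.mono (union_subset (h.labels_subset.trans hsub) hsubS)

theorem exists_explored {Q L : Set (Word m)} (h : Reachable P T R (.running Q L)) :
    ∃ C, Explored P T R Q L C := by
  have key : ∀ c, Reachable P T R c → ∀ Q L, c = .running Q L → ∃ C, Explored P T R Q L C := by
    intro c hc
    induction hc with
    | refl =>
      intro Q L h
      obtain ⟨rfl, rfl⟩ : Q = {[]} ∧ L = ∅ := by
        have := Config.running.inj h; exact ⟨this.1.symm, this.2.symm⟩
      exact ⟨∅, explored_initial⟩
    | @tail b c _ hs ih =>
      rintro Q L rfl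
      cases b with
      | returned out => exact absurd hs not_step_returned
      | running Q₀ L₀ =>
        obtain ⟨C, hC⟩ := ih Q₀ L₀ rfl
        exact hC.step hs
  exact key _ h Q L rfl

/-- The last configuration before an output is returned. -/
theorem Returns.exists_running {out : Option (Signal m)} (h : Returns P T R out) :
    ∃ Q L C, Explored P T R Q L C ∧ ((out = none ∧ Q = ∅) ∨
      ∃ u, IsPop P R Q u ∧ u.signal R ∈ P.goalSignals ∧ out = some (u.signal R)) := by
  rcases Relation.ReflTransGen.cases_tail h with h | ⟨c, hc, hs⟩
  · cases h
  · cases hs with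
    | fail L =>
      obtain ⟨C, hC⟩ := exists_explored hc
      exact ⟨∅, L, C, hC, .inl ⟨rfl, rfl⟩⟩
    | @goal Q L u hpop hgoal =>
      obtain ⟨C, hC⟩ := exists_explored hc
      exact ⟨Q, L, C, hC, .inr ⟨u, hpop, hgoal, rfl⟩⟩

end Invariant

end GLC

namespace GLC

open Set Filter Topology

/-! ### Comparison of the search with a string that has clearance. -/

section Optimality

variable {n m : ℕ} {P : Problem n m} {T : Params m} {uMax Lg Lf : ℝ} {R : ℕ}

theorem Word.terminalState_nil (hP : P.Assumptions uMax Lg Lf) :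
    P.terminalState (Word.signal R ([] : Word m)) = P.xIc := by
  have := (hP.isSolution_systemMap P.xIc (Word.isControl (R := R) (w := ([] : Word m))
    (by simp))).1.1
  simpa [Problem.terminalState, Word.signal] using this

/-- As long as the search has not returned a signal, the queue contains a string whose cost does
not exceed by much the cost of a given string with clearance. -/
theorem Explored.exists_mem_cost_le (hP : P.Assumptions uMax Lg Lf) (hR : 1 ≤ R)
    (hΩ : (T.Ω R : Set (Vec m)) ⊆ P.Ω) (hη : 0 < T.η R) {Q L C : Set (Word m)}
    (hE : Explored P T R Q L C) {w : Word m} (hne : w ≠ []) (hw : ∀ v ∈ w, v ∈ T.Ω R)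
    (hlen : w.length < T.h R) {δ D : ℝ}
    (hclear : ∀ t ∈ Icc 0 (w.signal R).dur, ∀ y,
      ‖y - P.systemMap P.xIc (w.signal R) t‖ ≤ δ → y ∈ P.Xfree)
    (hgoal : ∀ y, ‖y - P.terminalState (w.signal R)‖ ≤ δ → y ∈ P.Xgoal)
    (hD : Real.sqrt n / T.η R * (∑ j ∈ Finset.range w.length, Real.exp (Lf / R) ^ j)
      * Real.exp (Lf / R) ≤ D) (hDδ : D ≤ δ) :
    ∃ q ∈ Q, P.cost P.xIc (q.signal R)
      ≤ P.cost P.xIc (w.signal R) + w.length * (|Lg| * D / R) := by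
  have hR' : (0 : ℝ) < R := by exact_mod_cast hR
  have hwΩ : ∀ v ∈ w, v ∈ P.Ω := fun v hv => hΩ (hw v hv)
  set a : ℝ := Real.exp (Lf / R) with ha
  have ha1 : 1 ≤ a := Real.one_le_exp (div_nonneg hP.Lf_pos.le hR'.le)
  -- ρ bounds the diameter of a cell. The error after k steps is ρ S_k, where S_{k+1} = a S_k + 1:
  -- amplification by a, then one possible change of string within a cell.
  set ρ : ℝ := Real.sqrt n / T.η R with hρ
  have hρ0 : 0 ≤ ρ := by positivity
  set S : ℕ → ℝ := fun k => ∑ j ∈ Finset.range k, a ^ j with hS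
  -- The extra factor a covers the states in the interior of the next step.
  have hSle : ∀ {k}, k ≤ w.length → ρ * S k * a ≤ D := fun {k} hk => by
    refine le_trans ?_ hD
    have : S k ≤ S w.length := Finset.sum_le_sum_of_subset_of_nonneg (by simpa using hk)
      fun _ _ _ => by positivity
    gcongr
  have hS0 : ∀ k, 0 ≤ ρ * S k := fun k =>
    mul_nonneg hρ0 (Finset.sum_nonneg fun _ _ => by positivity)
  have hSsucc : ∀ k, ρ * S (k + 1) = ρ * S k * a + ρ := fun k => by
    simp only [hS]
    rw [geom_sum_succ]; ring
  have hD0 : 0 ≤ D := le_trans (mul_nonneg (hS0 0) (by positivity)) (hSle (Nat.zero_le _))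
  have he0 : 0 ≤ |Lg| * D / R := by positivity
  have hwfree : ∀ t ∈ Icc 0 (w.signal R).dur, P.systemMap P.xIc (w.signal R) t ∈ P.Xfree :=
    fun t ht => hclear t ht _ (by rw [sub_self, norm_zero]; exact hD0.trans hDδ)
  -- The chain may stop at any k where it meets the queue, since the remaining steps of w have
  -- nonnegative cost.
  have hdone : ∀ {z : Word m} {k : ℕ}, z ∈ Q → k ≤ w.length →
      P.cost P.xIc (z.signal R) ≤ w.partialCost P R k + k * (|Lg| * D / R) →
      ∃ q ∈ Q, P.cost P.xIc (q.signal R)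
        ≤ P.cost P.xIc (w.signal R) + w.length * (|Lg| * D / R) := by
    intro z k hz hk hcost
    refine ⟨z, hz, hcost.trans (add_le_add (Word.partialCost_mono hP hwΩ hwfree hk) ?_)⟩
    gcongr
  by_contra hcon
  -- The length bound excludes pruning by depth. The root has duration 0 and is not a free signal,
  -- so it must be ruled out at the end of the chain.
  have key : ∀ k ≤ w.length, ∃ z ∈ Q ∪ C, z.length ≤ k ∧ (z = [] → k = 0) ∧
      ‖P.terminalState (z.signal R) - P.systemMap P.xIc (w.signal R) ((k : ℝ) / R)‖ ≤ ρ * S k ∧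
      P.cost P.xIc (z.signal R) ≤ w.partialCost P R k + k * (|Lg| * D / R) := by
    intro k
    induction k with
    | zero =>
      intro _
      refine ⟨[], hE.root_mem, le_rfl, fun _ => rfl, ?_, ?_⟩
      · have := (hP.isSolution_systemMap P.xIc (Word.isControl (R := R) hwΩ)).1.1
        rw [Word.terminalState_nil hP, Nat.cast_zero, zero_div, this, sub_self, norm_zero]
        exact hS0 0
      · simp [Problem.cost, Word.partialCost, Word.signal]
    | succ k ih =>
      intro hk
      obtain ⟨z, hz, hzlen, -, hzp, hzc⟩ := ih (Nat.le_of_succ_le hk)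
      have hkw : k < w.length := hk
      have hzC : z ∈ C := hz.resolve_left fun hzQ => hcon (hdone hzQ hkw.le hzc)
      have hzT := hE.letters z hz
      have hzΩ : ∀ v ∈ z, v ∈ P.Ω := fun v hv => hΩ (hzT v hv)
      have hstep : ‖P.terminalState (z.signal R)
          - P.systemMap P.xIc (w.signal R) ((k : ℝ) / R)‖ * a ≤ ρ * S k * a := by gcongr
      obtain ⟨hxfree, hxc⟩ := Word.extend_mem_freeSignals hP hR hwΩ hzΩ (hE.free z hz) hclear hkw
        (hstep.trans (hSle hkw.le)) hDδ
      have hxp : ‖P.terminalState ((z ++ [w[k]]).signal R)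
          - P.systemMap P.xIc (w.signal R) (((k + 1 : ℕ) : ℝ) / R)‖ ≤ ρ * S k * a := by
        have := Word.norm_systemMap_extend_sub_le hP hR hwΩ hzΩ hkw (t := 1 / (R : ℝ))
          ⟨by positivity, le_rfl⟩
        have e1 : (z.length : ℝ) / R + 1 / R = ((z ++ [w[k]]).signal R).dur := by
          simp [Word.signal, add_div]
        have e2 : (k : ℝ) / R + 1 / R = ((k + 1 : ℕ) : ℝ) / R := by push_cast; ring
        rw [e1, e2] at this
        exact this.trans hstep
      have hxc' : P.cost P.xIc ((z ++ [w[k]]).signal R)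
          ≤ w.partialCost P R (k + 1) + ((k + 1 : ℕ) : ℝ) * (|Lg| * D / R) := by
        push_cast
        linarith
      have hxexp : z ++ [w[k]] ∈ expand T R z := by
        refine ⟨⟨by simp, ?_, fun v hv => ?_⟩, _, rfl⟩
        · rw [List.length_append, List.length_singleton]; omega
        · rcases List.mem_append.1 hv with hv | hv
          · exact hzT v hv
          · rw [List.mem_singleton.1 hv]; exact hw _ (List.getElem_mem hkw)
      -- The child is known; or not free, against the clearance; or too deep, against |w| < h(R); or
      -- dominated by y, which then continues the chain.
      rcases hE.children z hzC _ hxexp with hx | hx | hx | ⟨y, hy, hyne, hequiv, hdur, hcost⟩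
      · refine ⟨_, hx, by simpa using hzlen, by simp, hxp.trans ?_, hxc'⟩
        rw [hSsucc]; linarith
      · exact absurd hxfree hx
      · rw [List.length_append, List.length_singleton] at hx
        omega
      · refine ⟨y, hy, ?_, fun h => absurd h hyne, ?_, hcost.trans hxc'⟩
        · simp only [Word.signal] at hdur
          rw [div_le_div_iff_of_pos_right hR'] at hdur
          have : y.length ≤ (z ++ [w[k]]).length := by exact_mod_cast hdur
          rw [List.length_append, List.length_singleton] at this
          omega
        · have h1 := StateEquiv.norm_sub_le hη hequiv
          rw [hSsucc]
          have h2 := norm_sub_le_norm_sub_add_norm_sub (P.terminalState (y.signal R))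
            (P.terminalState ((z ++ [w[k]]).signal R))
            (P.systemMap P.xIc (w.signal R) (((k + 1 : ℕ) : ℝ) / R))
          linarith
  obtain ⟨z, hz, -, hz0, hzp, hzc⟩ := key w.length le_rfl
  have hzne : z ≠ [] := fun h => hne (List.length_eq_zero_iff.1 (hz0 h))
  have hzC : z ∈ C := hz.resolve_left fun hzQ => hcon (hdone hzQ le_rfl hzc)
  refine hE.not_goal z hzC ⟨(hE.free z hz).resolve_left hzne, hgoal _ ?_⟩
  refine (hzp.trans ?_).trans ((hSle le_rfl).trans hDδ)
  exact le_mul_of_one_le_right (hS0 _) ha1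

/-- The cost of the output compared with the cost of a string with clearance. -/
theorem Returns.exists_cost_le (hP : P.Assumptions uMax Lg Lf) (hR : 1 ≤ R)
    (hΩ : (T.Ω R : Set (Vec m)) ⊆ P.Ω) (hη : 0 < T.η R) {out : Option (Signal m)}
    (hout : Returns P T R out) {w : Word m} (hne : w ≠ []) (hw : ∀ v ∈ w, v ∈ T.Ω R)
    (hlen : w.length < T.h R) {δ D : ℝ}
    (hclear : ∀ t ∈ Icc 0 (w.signal R).dur, ∀ y,
      ‖y - P.systemMap P.xIc (w.signal R) t‖ ≤ δ → y ∈ P.Xfree)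
    (hgoal : ∀ y, ‖y - P.terminalState (w.signal R)‖ ≤ δ → y ∈ P.Xgoal)
    (hD : Real.sqrt n / T.η R * (∑ j ∈ Finset.range w.length, Real.exp (Lf / R) ^ j)
      * Real.exp (Lf / R) ≤ D) (hDδ : D ≤ δ) :
    P.extCost out ≤ ((P.cost P.xIc (w.signal R) + w.length * (|Lg| * D / R) : ℝ) : EReal) := by
  obtain ⟨Q, L, C, hE, h⟩ := hout.exists_running
  obtain ⟨q, hq, hle⟩ := hE.exists_mem_cost_le hP hR hΩ hη hne hw hlen hclear hgoal hD hDδ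
  rcases h with ⟨-, rfl⟩ | ⟨u, hpop, -, rfl⟩
  · exact absurd hq (notMem_empty q)
  · exact EReal.coe_le_coe_iff.2 ((hpop.2 q hq).trans hle)

/-- The accumulated effect of the pruning, in terms of the scaling condition. -/
theorem geom_sum_exp_le (hLf : 0 < Lf) (hR : 1 ≤ R) {d h : ℕ} (hd : d ≤ h) :
    ∑ j ∈ Finset.range d, Real.exp (Lf / R) ^ j
      ≤ (R : ℝ) / Lf * (Real.exp (Lf * h / R) - 1) := by
  have hR' : (0 : ℝ) < R := by exact_mod_cast hR
  -- This replaces the denominator e^{Lf/R} - 1 of the geometric sum by Lf/R.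
  have h1 : Lf / R ≤ Real.exp (Lf / R) - 1 := by
    have := Real.add_one_le_exp (Lf / R); linarith
  have h2 : Real.exp (Lf * h / R) = Real.exp (Lf / R) ^ h := by
    rw [← Real.exp_nat_mul]; ring_nf
  have h3 : 1 ≤ Real.exp (Lf / R) := Real.one_le_exp (by positivity)
  have h4 : (∑ j ∈ Finset.range d, Real.exp (Lf / R) ^ j) * (Lf / R)
      ≤ Real.exp (Lf * h / R) - 1 := by
    calc _ ≤ (∑ j ∈ Finset.range d, Real.exp (Lf / R) ^ j) * (Real.exp (Lf / R) - 1) := by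
          gcongr
      _ = Real.exp (Lf / R) ^ d - 1 := geom_sum_mul _ _
      _ ≤ _ := by rw [h2]; gcongr
  rw [← div_le_iff₀' (by positivity)]
  calc _ = (∑ j ∈ Finset.range d, Real.exp (Lf / R) ^ j) * (Lf / R) := by field_simp
    _ ≤ _ := h4

end Optimality

end GLC

namespace GLC

open MeasureTheory Set Filter Topology

/-! ### Approximation of goal signals by strings. -/

section Density

theorem tendsto_intervalIntegral_zero {F : ℕ → ℝ → ℝ} {τ C : ℝ} (hτ : 0 ≤ τ)
    (hmeas : ∀ᶠ k in atTop, AEStronglyMeasurable (F k) (volume.restrict (Icc 0 τ)))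
    (hbound : ∀ᶠ k in atTop, ∀ᵐ s ∂volume.restrict (Icc 0 τ), ‖F k s‖ ≤ C)
    (hlim : ∀ᵐ s ∂volume.restrict (Icc 0 τ), Tendsto (fun k => F k s) atTop (𝓝 0)) :
    Tendsto (fun k => ∫ s in (0 : ℝ)..τ, F k s) atTop (𝓝 0) := by
  have h := tendsto_integral_filter_of_dominated_convergence (fun _ => C) hmeas hbound
    (integrable_const C) hlim
  simpa only [intervalIntegral.integral_of_le hτ, integral_Icc_eq_integral_Ioc, integral_zero]
    using h

variable {n m : ℕ} {P : Problem n m} {T : Params m} {uMax Lg Lf : ℝ}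

theorem Params.Admissible.eventually_exists_dist_lt (hT : T.Admissible P Lf) {ε : ℝ} (hε : 0 < ε) :
    ∀ᶠ R in atTop, ∀ w ∈ P.Ω, ∃ v ∈ T.Ω R, dist w v < ε := by
  have h := hT.dispersion.eventually_lt_const (ENNReal.ofReal_pos.2 hε)
  filter_upwards [h] with R hR w hw
  have h1 : ⨅ v ∈ T.Ω R, edist w v < ENNReal.ofReal ε :=
    (le_iSup₂ (f := fun w (_ : w ∈ P.Ω) => ⨅ v ∈ T.Ω R, edist w v) w hw).trans_lt hR
  obtain ⟨v, hv⟩ := iInf_lt_iff.1 h1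
  obtain ⟨hvΩ, hv⟩ := iInf_lt_iff.1 hv
  exact ⟨v, hvΩ, by rwa [edist_lt_ofReal] at hv⟩

/-- Approximation of an input signal by piecewise constant ones with values in `Ω_R`. -/
theorem exists_tendsto_piecewise (hT : T.Admissible P Lf) {u : Signal m} (hu : u ∈ P.signalSpace) :
    ∃ c : ℕ → ℕ → Vec m, (∀ᶠ R in atTop, ∀ i, c R i ∈ T.Ω R) ∧
      ∀ᵐ t ∂volume.restrict (Icc 0 u.dur),
        Tendsto (fun R : ℕ => c R ⌊t * (R : ℝ)⌋₊) atTop (𝓝 (u.val t)) := by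
  let U : ℝ → Vec m := indicator (Icc 0 u.dur) u.val
  have hU : LocallyIntegrable U volume :=
    ((integrable_indicator_iff measurableSet_Icc).2 hu.2.1).locallyIntegrable
  -- Midpoint and half-length of a grid cell, so that the closed ball is [i/R, (i+1)/R].
  let ctr : ℕ → ℕ → ℝ := fun R i => ((i : ℝ) + 1 / 2) / R
  let r : ℕ → ℝ := fun R => 1 / 2 / R
  let avg : ℕ → ℕ → Vec m := fun R i => ⨍ y in Metric.closedBall (ctr R i) (r R), U y
  have hex : ∀ R i, ∃ v, (T.Ω R).Nonempty →
      v ∈ T.Ω R ∧ ∀ v' ∈ T.Ω R, dist v (avg R i) ≤ dist v' (avg R i) := by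
    intro R i
    by_cases h : (T.Ω R).Nonempty
    · obtain ⟨v, hv, hv'⟩ := (T.Ω R).exists_min_image (fun v => dist v (avg R i)) h
      exact ⟨v, fun _ => ⟨hv, hv'⟩⟩
    · exact ⟨0, fun h' => absurd h' h⟩
  choose c hc using hex
  have hΩ : u.val 0 ∈ P.Ω := hu.2.2 0 ⟨le_rfl, hu.1.le⟩
  have hne : ∀ᶠ R in atTop, (T.Ω R).Nonempty := by
    filter_upwards [hT.eventually_exists_dist_lt one_pos] with R hR
    obtain ⟨v, hv, -⟩ := hR _ hΩ
    exact ⟨v, hv⟩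
  refine ⟨c, hne.mono fun R hR i => (hc R i hR).1, ?_⟩
  have hr : Tendsto r atTop (𝓝[>] 0) := by
    refine tendsto_nhdsWithin_iff.2 ⟨tendsto_const_div_atTop_nhds_zero_nat _, ?_⟩
    filter_upwards [eventually_ge_atTop 1] with R hR
    have : (0 : ℝ) < R := by exact_mod_cast hR
    simp only [r, mem_Ioi]; positivity
  -- Lebesgue differentiation along balls that contain t without being centred at t.
  filter_upwards [ae_restrict_of_ae (IsUnifLocDoublingMeasure.ae_tendsto_average volume hU 1),
    ae_restrict_mem measurableSet_Icc] with t ht htmem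
  have htU : U t = u.val t := indicator_of_mem htmem _
  have havg := ht (fun R : ℕ => ctr R ⌊t * (R : ℝ)⌋₊) r hr (by
    filter_upwards [eventually_ge_atTop 1] with R hR
    have hR' : (0 : ℝ) < R := by exact_mod_cast hR
    have h0 : 0 ≤ t * R := mul_nonneg htmem.1 hR'.le
    have h1 := Nat.floor_le h0
    have h2 := Nat.lt_floor_add_one (t * (R : ℝ))
    have h3 : t - ((⌊t * (R : ℝ)⌋₊ : ℝ) + 1 / 2) / R
        = (t * R - ((⌊t * (R : ℝ)⌋₊ : ℝ) + 1 / 2)) / R := by field_simp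
    rw [Metric.mem_closedBall, Real.dist_eq, one_mul]
    simp only [ctr, r]
    rw [h3, abs_div, abs_of_pos hR']
    gcongr
    rw [abs_le]
    constructor <;> linarith)
  rw [htU] at havg
  rw [Metric.tendsto_nhds] at havg ⊢
  intro ε hε
  filter_upwards [havg (ε / 3) (by positivity), hne,
    hT.eventually_exists_dist_lt (ε := ε / 3) (by positivity)] with R h1 h2 h3
  -- Ω need not be convex, so the average may lie far from Ω_R. Dispersion is applied at u(t)
  -- instead, and the choice c nearest to the average satisfies |c - u(t)| ≤ |v - u(t)| + 2 |avg -
  -- u(t)| < ε.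
  obtain ⟨v, hv, hvd⟩ := h3 _ (hu.2.2 t htmem)
  have h4 := (hc R ⌊t * (R : ℝ)⌋₊ h2).2 v hv
  have h5 := dist_triangle (c R ⌊t * (R : ℝ)⌋₊) (avg R ⌊t * (R : ℝ)⌋₊) (u.val t)
  have h6 := dist_triangle v (u.val t) (avg R ⌊t * (R : ℝ)⌋₊)
  rw [dist_comm v (u.val t), dist_comm (u.val t) (avg R _)] at h6
  have h7 : dist (avg R ⌊t * (R : ℝ)⌋₊) (u.val t) < ε / 3 := h1
  linarith

theorem measurable_comp_floor (R : ℕ) (c : ℕ → Vec m) :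
    Measurable fun t : ℝ => c ⌊t * (R : ℝ)⌋₊ :=
  (measurable_from_nat (f := c)).comp (Nat.measurable_floor.comp (measurable_id.mul_const _))

theorem isControl_comp_floor {R : ℕ} {c : ℕ → Vec m} (hc : ∀ i, c i ∈ P.Ω) (τ : ℝ) :
    P.IsControl τ fun t => c ⌊t * (R : ℝ)⌋₊ :=
  ⟨(measurable_comp_floor R c).aestronglyMeasurable, Eventually.of_forall fun _ => hc _⟩

/-- The string of the first `d` values of `c`. -/
theorem Word.signal_map_range_ae {R : ℕ} (hR : 1 ≤ R) (c : ℕ → Vec m) (d : ℕ) :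
    (Word.signal R ((List.range d).map c)).val
      =ᵐ[volume.restrict (Icc 0 ((d : ℝ) / R))] fun t => c ⌊t * (R : ℝ)⌋₊ := by
  have hR' : (0 : ℝ) < R := by exact_mod_cast hR
  filter_upwards [ae_restrict_of_ae (Measure.ae_ne volume ((d : ℝ) / R)),
    ae_restrict_mem measurableSet_Icc] with t ht htm
  have hfl : ⌊t * (R : ℝ)⌋₊ < d := by
    rw [Nat.floor_lt (mul_nonneg htm.1 hR'.le), ← lt_div_iff₀ hR']
    exact lt_of_le_of_ne htm.2 ht
  rw [Word.signal_val_of_floor_eq (by simpa using hfl) rfl]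
  simp

variable (hP : P.Assumptions uMax Lg Lf)
include hP

/-- Since f is only continuous in the control, the effect of changing the control is measured along
the fixed trajectory of u, where dominated convergence applies; Gronwall absorbs the rest. -/
theorem norm_systemMap_map_range_sub_le {u : Signal m} (hu : P.IsControl u.dur u.val) {R : ℕ}
    (hR : 1 ≤ R) {c : ℕ → Vec m} (hc : ∀ i, c i ∈ P.Ω) {d : ℕ} (hd : (d : ℝ) / R ≤ u.dur) :
    ∀ t ∈ Icc 0 ((d : ℝ) / R),
      ‖P.systemMap P.xIc (Word.signal R ((List.range d).map c)) t - P.systemMap P.xIc u t‖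
        ≤ (∫ s in (0 : ℝ)..u.dur, ‖P.f (P.systemMap P.xIc u s) (c ⌊s * (R : ℝ)⌋₊)
            - P.f (P.systemMap P.xIc u s) (u.val s)‖) * Real.exp (Lf * u.dur) := by
  intro t ht
  have h0 : (0 : ℝ) ≤ (d : ℝ) / R := by positivity
  have hdur : (Word.signal R ((List.range d).map c)).dur = (d : ℝ) / R := by simp [Word.signal]
  have hwc : P.IsControl ((d : ℝ) / R) (Word.signal R ((List.range d).map c)).val := by
    rw [← hdur]
    refine Word.isControl fun v hv => ?_
    obtain ⟨i, -, rfl⟩ := List.mem_map.1 hv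
    exact hc i
  have hsol := hP.isSolution_systemMap P.xIc hu
  have hsolw := hP.isSolution_systemMap P.xIc (u := Word.signal R ((List.range d).map c))
    (by rwa [hdur])
  rw [Problem.IsSolution, Problem.IsTrajectory, hdur] at hsolw
  have hcx := hsol.1.2.continuousOn
  have hcx' := hcx.mono (Icc_subset_Icc_right hd)
  have hβ := ((hP.intervalIntegrable_f (h0.trans hd) (isControl_comp_floor (R := R) hc _) hcx).sub
    (hP.intervalIntegrable_f (h0.trans hd) hu hcx)).norm
  have hsub : uIcc 0 ((d : ℝ) / R) ⊆ uIcc 0 u.dur := by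
    rw [uIcc_of_le h0, uIcc_of_le (h0.trans hd)]
    exact Icc_subset_Icc_right hd
  have key := norm_sub_le_of_integral_eq h0 hP.Lf_pos.le hsolw.1.2.continuousOn hcx'
    hsolw.2 (fun t ht => hsol.2 t ⟨ht.1, ht.2.trans hd⟩)
    (hP.intervalIntegrable_f h0 hwc hsolw.1.2.continuousOn)
    (hP.intervalIntegrable_f h0 (hu.mono hd) hcx') (hβ.mono_set hsub)
    (Eventually.of_forall fun s => norm_nonneg _) (by
      filter_upwards [Word.signal_map_range_ae hR c d, (hu.mono hd).2] with s hs hs'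
      rw [hs]
      have h1 := hP.f_lipschitz _ (hc ⌊s * (R : ℝ)⌋₊)
        (P.systemMap P.xIc (Word.signal R ((List.range d).map c)) s) (P.systemMap P.xIc u s)
      exact (norm_sub_le_norm_sub_add_norm_sub _
        (P.f (P.systemMap P.xIc u s) (c ⌊s * (R : ℝ)⌋₊)) _).trans (add_le_add_left h1 _)) t ht
  rw [sub_self, norm_zero, zero_add] at key
  refine key.trans ?_
  have hmono := intervalIntegral.integral_mono_interval le_rfl h0 hd
    (Eventually.of_forall fun s => norm_nonneg _) hβ
  have hexp : Real.exp (Lf * t) ≤ Real.exp (Lf * u.dur) :=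
    Real.exp_le_exp.2 (mul_le_mul_of_nonneg_left (ht.2.trans hd) hP.Lf_pos.le)
  refine mul_le_mul hmono hexp (Real.exp_pos _).le ?_
  exact intervalIntegral.integral_nonneg (h0.trans hd) fun _ _ => norm_nonneg _

/-- The costs are compared on [0, d/R]; enlarging the interval to that of u only increases the
right-hand side, because g > 0. -/
theorem cost_map_range_le {u : Signal m} (hu : u ∈ P.freeSignals) {R : ℕ}
    (hR : 1 ≤ R) {c : ℕ → Vec m} (hc : ∀ i, c i ∈ P.Ω) {d : ℕ} (hd : (d : ℝ) / R ≤ u.dur) {E : ℝ}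
    (hE : ∀ t ∈ Icc 0 ((d : ℝ) / R),
      ‖P.systemMap P.xIc (Word.signal R ((List.range d).map c)) t - P.systemMap P.xIc u t‖ ≤ E)
    (hfree : ∀ t ∈ Icc 0 ((d : ℝ) / R),
      P.systemMap P.xIc (Word.signal R ((List.range d).map c)) t ∈ P.Xfree) :
    P.cost P.xIc (Word.signal R ((List.range d).map c))
      ≤ P.cost P.xIc u
        + |Lg| * (u.dur * E + ∫ s in (0 : ℝ)..u.dur, ‖c ⌊s * (R : ℝ)⌋₊ - u.val s‖) := by
  have h0 : (0 : ℝ) ≤ (d : ℝ) / R := by positivity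
  have hE0 : 0 ≤ E := (norm_nonneg _).trans (hE 0 ⟨le_rfl, h0⟩)
  have huc := Problem.isControl_of_mem_signalSpace hu.1
  have hdur : (Word.signal R ((List.range d).map c)).dur = (d : ℝ) / R := by simp [Word.signal]
  have hwΩ : ∀ v ∈ (List.range d).map c, v ∈ P.Ω := fun v hv => by
    obtain ⟨i, -, rfl⟩ := List.mem_map.1 hv
    exact hc i
  have iw := Word.intervalIntegrable_g (R := R) hP hwΩ (by rwa [hdur])
  have iu := hP.intervalIntegrable_g (h0.trans hd) huc (hP.continuousOn_systemMap P.xIc huc) hu.2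
  have hfl := isControl_comp_floor (P := P) (R := R) hc u.dur
  have ib : IntervalIntegrable (fun s => ‖c ⌊s * (R : ℝ)⌋₊ - u.val s‖) volume 0 u.dur := by
    rw [intervalIntegrable_iff_integrableOn_Icc_of_le (h0.trans hd)]
    refine Integrable.of_bound (hfl.1.sub huc.1).norm (uMax + uMax) ?_
    filter_upwards [huc.2] with s hs
    rw [norm_norm]
    exact (norm_sub_le _ _).trans
      (add_le_add (hP.norm_le_of_mem _ (hc _)) (hP.norm_le_of_mem _ hs))
  have hsub : uIcc 0 ((d : ℝ) / R) ⊆ uIcc 0 u.dur := by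
    rw [uIcc_of_le h0, uIcc_of_le (h0.trans hd)]
    exact Icc_subset_Icc_right hd
  have ib' := (intervalIntegrable_const (μ := volume) (a := (0 : ℝ)) (b := u.dur) (c := E)).add ib
  have iR := iu.add (ib'.const_mul |Lg|)
  rw [hdur] at iw
  have h1 : P.cost P.xIc (Word.signal R ((List.range d).map c))
      ≤ ∫ s in (0 : ℝ)..((d : ℝ) / R), (P.g (P.systemMap P.xIc u s) (u.val s)
        + |Lg| * (E + ‖c ⌊s * (R : ℝ)⌋₊ - u.val s‖)) := by
    rw [Problem.cost, hdur]
    refine intervalIntegral.integral_mono_ae_restrict h0 iw (iR.mono_set hsub) ?_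
    filter_upwards [Word.signal_map_range_ae hR c d, (huc.mono hd).2,
      ae_restrict_mem measurableSet_Icc] with s hs hs' hsm
    rw [hs]
    have h2 := hP.abs_g_sub_le (hfree s hsm) (hu.2 s ⟨hsm.1, hsm.2.trans hd⟩)
      (hc ⌊s * (R : ℝ)⌋₊) hs'
    have h3 : |Lg| * (‖P.systemMap P.xIc (Word.signal R ((List.range d).map c)) s
        - P.systemMap P.xIc u s‖ + ‖c ⌊s * (R : ℝ)⌋₊ - u.val s‖)
        ≤ |Lg| * (E + ‖c ⌊s * (R : ℝ)⌋₊ - u.val s‖) := by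
      gcongr
      exact hE s hsm
    have h4 := (le_abs_self _).trans (h2.trans h3)
    linarith
  refine h1.trans ((intervalIntegral.integral_mono_interval le_rfl h0 hd ?_ iR).trans ?_)
  · refine ae_restrict_of_ae_restrict_of_subset Ioc_subset_Icc_self ?_
    filter_upwards [huc.2, ae_restrict_mem measurableSet_Icc] with s hs hsm
    have := hP.g_pos _ (hu.2 s hsm) _ hs
    simp only [Pi.zero_apply]
    positivity
  · rw [intervalIntegral.integral_add iu (ib'.const_mul |Lg|),
      intervalIntegral.integral_const_mul, intervalIntegral.integral_add
      intervalIntegrable_const ib, intervalIntegral.integral_const, smul_eq_mul, sub_zero]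
    exact le_rfl

/-- Every goal signal is approximated, with uniform clearance and without a loss in the limit of
the cost, by strings of primitive signals. -/
theorem exists_word_near (hT : T.Admissible P Lf) {u : Signal m} (hu : u ∈ P.goalSignals) {ε : ℝ}
    (hε : 0 < ε) :
    ∃ δ : ℝ, 0 < δ ∧ ∀ᶠ R : ℕ in atTop, ∃ w : Word m, w ≠ [] ∧ (∀ v ∈ w, v ∈ T.Ω R) ∧
      (w.length : ℝ) / R ≤ u.dur ∧
      (∀ t ∈ Icc 0 (w.signal R).dur, ∀ y,
        ‖y - P.systemMap P.xIc (w.signal R) t‖ ≤ δ → y ∈ P.Xfree) ∧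
      (∀ y, ‖y - P.terminalState (w.signal R)‖ ≤ δ → y ∈ P.Xgoal) ∧
      P.cost P.xIc (w.signal R) ≤ P.cost P.xIc u + ε := by
  obtain ⟨c, hcΩ, hclim⟩ := exists_tendsto_piecewise hT hu.1.1
  have huc := Problem.isControl_of_mem_signalSpace hu.1.1
  have hτ : 0 < u.dur := hu.1.1.1
  have hsol := hP.isSolution_systemMap P.xIc huc
  have hcx := hsol.1.2.continuousOn
  set X := P.systemMap P.xIc u with hX
  have hcP : ∀ᶠ R : ℕ in atTop, ∀ i, c R i ∈ P.Ω := by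
    filter_upwards [hcΩ, eventually_ge_atTop 1] with R h1 h2 i using hT.subset R h2 (h1 i)
  have hA : Tendsto (fun R : ℕ => ∫ s in (0 : ℝ)..u.dur,
      ‖P.f (X s) (c R ⌊s * (R : ℝ)⌋₊) - P.f (X s) (u.val s)‖) atTop (𝓝 0) := by
    refine tendsto_intervalIntegral_zero (C := (P.M : ℝ) + P.M) hτ.le ?_ ?_ ?_
    · filter_upwards [hcP] with R hR
      exact ((hP.aestronglyMeasurable_f (isControl_comp_floor hR _) hcx).sub
        (hP.aestronglyMeasurable_f huc hcx)).norm
    · filter_upwards [hcP] with R hR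
      filter_upwards [huc.2] with s hs
      rw [norm_norm]
      exact (norm_sub_le _ _).trans (add_le_add (hP.f_bounded _ _ (hR _)) (hP.f_bounded _ _ hs))
    · filter_upwards [hclim, huc.2] with s hs hsΩ
      have h1 : Tendsto (fun R : ℕ => P.f (X s) (c R ⌊s * (R : ℝ)⌋₊)) atTop
          (𝓝 (P.f (X s) (u.val s))) :=
        (hP.f_continuous (X s) _ hsΩ).tendsto.comp
          (tendsto_nhdsWithin_iff.2 ⟨hs, hcP.mono fun R hR => hR _⟩)
      simpa using (h1.sub_const (P.f (X s) (u.val s))).norm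
  have hB : Tendsto (fun R : ℕ => ∫ s in (0 : ℝ)..u.dur, ‖c R ⌊s * (R : ℝ)⌋₊ - u.val s‖)
      atTop (𝓝 0) := by
    refine tendsto_intervalIntegral_zero (C := uMax + uMax) hτ.le ?_ ?_ ?_
    · exact Eventually.of_forall fun R =>
        ((measurable_comp_floor R (c R)).aestronglyMeasurable.sub huc.1).norm
    · filter_upwards [hcP] with R hR
      filter_upwards [huc.2] with s hs
      rw [norm_norm]
      exact (norm_sub_le _ _).trans
        (add_le_add (hP.norm_le_of_mem _ (hR _)) (hP.norm_le_of_mem _ hs))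
    · filter_upwards [hclim] with s hs
      simpa using (hs.sub_const (u.val s)).norm
  -- The trajectory of u is compact in an open set, which gives a clearance uniform in time.
  obtain ⟨δ₁, hδ₁, hfree⟩ := (isCompact_Icc.image_of_continuousOn hcx).exists_cthickening_subset_open
    hP.isOpen_free (by rintro _ ⟨t, ht, rfl⟩; exact hu.1.2 t ht)
  obtain ⟨δ₂, hδ₂, hgoal⟩ := Metric.isOpen_iff.1 hP.isOpen_goal _ hu.2
  set δ := min δ₁ δ₂ with hδ
  have hδ0 : 0 < δ := lt_min hδ₁ hδ₂
  have hE := hA.mul_const (Real.exp (Lf * u.dur))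
  rw [zero_mul] at hE
  have hcost := (((hE.const_mul u.dur).add hB).const_mul |Lg|)
  simp only [mul_zero, add_zero] at hcost
  have hM : Tendsto (fun R : ℕ => (P.M : ℝ) / R) atTop (𝓝 0) :=
    tendsto_const_div_atTop_nhds_zero_nat _
  -- At the goal three errors of δ/4 add up: the perturbation, the distance of the trajectories, and
  -- the motion of at most M/R in the truncated time. The fourth quarter gives strict inequality.
  refine ⟨δ / 4, by positivity, ?_⟩
  have hlarge : ∀ᶠ R : ℕ in atTop, 1 ≤ u.dur * (R : ℝ) :=
    (tendsto_natCast_atTop_atTop.const_mul_atTop hτ).eventually_ge_atTop 1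
  filter_upwards [hcΩ, hcP, eventually_ge_atTop 1, hlarge,
    hE.eventually_le_const (show (0 : ℝ) < δ / 4 by positivity), hcost.eventually_le_const hε,
    hM.eventually_le_const (show (0 : ℝ) < δ / 4 by positivity)] with R r1 r2 r3 r4 r5 r6 r7
  have hR' : (0 : ℝ) < R := by exact_mod_cast r3
  set d := ⌊u.dur * (R : ℝ)⌋₊ with hd
  have hd1 : 1 ≤ d := Nat.le_floor (by simpa using r4)
  have hdle : (d : ℝ) / R ≤ u.dur := by
    rw [div_le_iff₀ hR']
    exact Nat.floor_le (by positivity)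
  have hdge : u.dur - (d : ℝ) / R ≤ 1 / R := by
    have := Nat.lt_floor_add_one (u.dur * (R : ℝ))
    have h1 : u.dur < ((d : ℝ) + 1) / R := by rwa [lt_div_iff₀ hR']
    rw [add_div] at h1
    linarith
  have hd0 : (0 : ℝ) ≤ (d : ℝ) / R := by positivity
  set w : Word m := (List.range d).map (c R) with hw
  have hdur : (w.signal R).dur = (d : ℝ) / R := by simp [hw, Word.signal]
  have hnear := norm_systemMap_map_range_sub_le hP huc r3 r2 hdle
  have hclear : ∀ t ∈ Icc 0 (w.signal R).dur, ∀ y,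
      ‖y - P.systemMap P.xIc (w.signal R) t‖ ≤ δ / 4 → y ∈ P.Xfree := by
    intro t ht y hy
    rw [hdur] at ht
    refine hfree (Metric.mem_cthickening_of_dist_le y (X t) _ _
      (mem_image_of_mem _ ⟨ht.1, ht.2.trans hdle⟩) ?_)
    have h1 := (hnear t ht).trans r5
    have h2 := norm_sub_le_norm_sub_add_norm_sub y (P.systemMap P.xIc (w.signal R) t) (X t)
    have h3 : δ ≤ δ₁ := min_le_left _ _
    rw [dist_eq_norm]
    linarith
  refine ⟨w, ?_, ?_, ?_, hclear, ?_, ?_⟩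
  · intro h
    have := congrArg List.length h
    simp only [hw, List.length_map, List.length_range, List.length_nil] at this
    omega
  · intro v hv
    obtain ⟨i, -, rfl⟩ := List.mem_map.1 hv
    exact r1 i
  · simpa [hw] using hdle
  · intro y hy
    refine hgoal ?_
    rw [Problem.terminalState, hdur] at hy
    have h1 := (hnear _ ⟨hd0, le_rfl⟩).trans r5
    have h2 := norm_sub_le_norm_sub_add_norm_sub y
      (P.systemMap P.xIc (w.signal R) ((d : ℝ) / R)) (X ((d : ℝ) / R))
    have h3 := norm_sub_le_norm_sub_add_norm_sub y (X ((d : ℝ) / R)) (X u.dur)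
    have h4 := hsol.1.2.dist_le_mul _ ⟨hd0, hdle⟩ _ (right_mem_Icc.2 hτ.le)
    rw [dist_eq_norm, Real.dist_eq, abs_sub_comm, abs_of_nonneg (sub_nonneg.2 hdle)] at h4
    have h5 : (P.M : ℝ) * (u.dur - (d : ℝ) / R) ≤ P.M / R := by
      rw [div_eq_mul_one_div (P.M : ℝ)]
      gcongr
    have h6 : δ ≤ δ₂ := min_le_right _ _
    rw [Metric.mem_ball, dist_eq_norm]
    change ‖y - X u.dur‖ < δ₂
    linarith
  · have h1 := cost_map_range_le hP hu.1 r3 r2 hdle hnear fun t ht =>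
      hclear t (by rwa [hdur]) _ (by rw [sub_self, norm_zero]; positivity)
    exact h1.trans (add_le_add_right r6 _)

end Density

end GLC

namespace GLC

open Filter Topology

/-! ### Convergence of the costs. -/

section Completeness

variable {n m : ℕ} {P : Problem n m} {T : Params m} {uMax Lg Lf : ℝ}

theorem Returns.eq_none_or_goal {R : ℕ} {out : Option (Signal m)} (h : Returns P T R out) :
    out = none ∨ ∃ u ∈ P.goalSignals, out = some u := by
  obtain ⟨Q, L, C, -, ⟨h, -⟩ | ⟨u, -, hu, h⟩⟩ := h.exists_running
  · exact .inl h
  · exact .inr ⟨_, hu, h⟩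

theorem Returns.optimalCost_le {R : ℕ} {out : Option (Signal m)} (h : Returns P T R out) :
    P.optimalCost ≤ P.extCost out := by
  rcases h.eq_none_or_goal with rfl | ⟨u, hu, rfl⟩
  · exact le_top
  · exact iInf₂_le u hu

/-- In the limit, the outputs do not cost more than any given goal signal. -/
theorem eventually_extCost_le (hP : P.Assumptions uMax Lg Lf) (hT : T.Admissible P Lf)
    {w : ℕ → Option (Signal m)} (hw : ∀ R : ℕ, 1 ≤ R → Returns P T R (w R)) {u : Signal m}
    (hu : u ∈ P.goalSignals) {ε : ℝ} (hε : 0 < ε) :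
    ∀ᶠ R in atTop, P.extCost (w R) ≤ ((P.cost P.xIc u + ε : ℝ) : EReal) := by
  obtain ⟨δ, hδ, hnear⟩ := exists_word_near hP hT hu (half_pos hε)
  have hτ : 0 < u.dur := hu.1.1.1
  -- The accumulated pruning error, with the geometric sum bounded by the scaling term and e^{Lf/R}
  -- by e^{Lf}, as R ≥ 1.
  let D : ℕ → ℝ := fun R => Real.sqrt n
    * ((R : ℝ) / (Lf * T.η R) * (Real.exp (Lf * (T.h R : ℝ) / (R : ℝ)) - 1)) * Real.exp Lf
  have hD : Tendsto D atTop (𝓝 0) := by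
    have := (hT.scaling.const_mul (Real.sqrt n)).mul_const (Real.exp Lf)
    simpa only [mul_zero, zero_mul] using this
  have hD' : Tendsto (fun R => u.dur * (|Lg| * D R)) atTop (𝓝 0) := by
    simpa only [mul_zero] using (hD.const_mul |Lg|).const_mul u.dur
  filter_upwards [hnear, eventually_ge_atTop 1, hD.eventually_le_const hδ,
    hD'.eventually_le_const (half_pos hε),
    -- This gives h(R) > R (τ(u) + 1), so strings of duration at most τ(u) have length strictly
    -- below h(R).
    hT.horizon.eventually_lt_const (show (0 : ℝ) < 1 / (u.dur + 1) by positivity)]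
    with R ⟨v, hne, hvΩ, hlen, hclear, hgoal, hcost⟩ hR hDδ hDε hhor
  have hR' : (0 : ℝ) < R := by exact_mod_cast hR
  have hη := hT.η_pos R hR
  have hLf := hP.Lf_pos
  have hh : (0 : ℝ) < T.h R := by exact_mod_cast hT.h_pos R hR
  have hlt : v.length < T.h R := by
    rw [div_lt_div_iff₀ hh (by positivity), one_mul] at hhor
    rw [div_le_iff₀ hR'] at hlen
    have : (v.length : ℝ) < T.h R := by linarith
    exact_mod_cast this
  have hexp : Real.exp (Lf / R) ≤ Real.exp Lf :=
    Real.exp_le_exp.2 (div_le_self hLf.le (by exact_mod_cast hR))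
  have hsum := geom_sum_exp_le hLf hR hlt.le
  have hsum0 : 0 ≤ ∑ j ∈ Finset.range v.length, Real.exp (Lf / R) ^ j :=
    Finset.sum_nonneg fun _ _ => by positivity
  have hDge : Real.sqrt n / T.η R * (∑ j ∈ Finset.range v.length, Real.exp (Lf / R) ^ j)
      * Real.exp (Lf / R) ≤ D R := by
    calc _ ≤ Real.sqrt n / T.η R * ((R : ℝ) / Lf * (Real.exp (Lf * (T.h R : ℝ) / R) - 1))
          * Real.exp Lf := by gcongr; exact mul_nonneg (by positivity) (hsum0.trans hsum)
      _ = D R := by simp only [D]; field_simp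
  have hD0 : 0 ≤ D R := le_trans (by positivity) hDge
  refine ((hw R hR).exists_cost_le hP hR (hT.subset R hR) hη hne hvΩ hlt hclear hgoal hDge
    hDδ).trans (EReal.coe_le_coe_iff.2 ?_)
  have : (v.length : ℝ) * (|Lg| * D R / R) ≤ u.dur * (|Lg| * D R) := by
    calc (v.length : ℝ) * (|Lg| * D R / R) = v.length / R * (|Lg| * D R) := by ring
      _ ≤ _ := by gcongr
  linarith

/-- Working in the order topology of `EReal` covers c* = ∞ as well: no b then exceeds c*, and only
the lower bound has content. -/
theorem tendsto_extCost (hP : P.Assumptions uMax Lg Lf) (hT : T.Admissible P Lf)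
    {w : ℕ → Option (Signal m)} (hw : ∀ R : ℕ, 1 ≤ R → Returns P T R (w R)) :
    Tendsto (fun R : ℕ => P.extCost (w R)) atTop (𝓝 P.optimalCost) := by
  refine tendsto_order.2 ⟨fun a ha => ?_, fun b hb => ?_⟩
  · filter_upwards [eventually_ge_atTop 1] with R hR
    exact ha.trans_le (hw R hR).optimalCost_le
  · obtain ⟨u, hu⟩ := iInf_lt_iff.1 hb
    obtain ⟨hug, hu⟩ := iInf_lt_iff.1 hu
    obtain ⟨c, hc, hcb⟩ := EReal.lt_iff_exists_real_btwn.1 hu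
    have hc' : P.cost P.xIc u < c := EReal.coe_lt_coe_iff.1 hc
    filter_upwards [eventually_extCost_le hP hT hw hug (sub_pos.2 hc')] with R hR
    rw [add_sub_cancel] at hR
    exact hR.trans_lt hcb

end Completeness

end GLC

theorem corollary5p1 {n m : ℕ} (P : GLC.Problem n m) (T : GLC.Params m) (uMax Lg Lf : ℝ)
    (hP : P.Assumptions uMax Lg Lf) (hT : T.Admissible P Lf) :
    (∀ R : ℕ, 1 ≤ R → GLC.Terminates P T R) ∧
      ∀ w : ℕ → Option (GLC.Signal m), (∀ R : ℕ, 1 ≤ R → GLC.Returns P T R (w R)) →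
        (∀ R : ℕ, 1 ≤ R → w R = none ∨ ∃ u ∈ P.goalSignals, w R = some u) ∧
        Filter.Tendsto (fun R : ℕ => P.extCost (w R)) Filter.atTop (nhds P.optimalCost) := by
  exact ⟨fun _ _ => GLC.terminates, fun _ hw =>
    ⟨fun R hR => (hw R hR).eq_none_or_goal, GLC.tendsto_extCost hP hT hw⟩⟩
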